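/- **Setting.** Let $S=(a,b)$ and $K=(c,d)$ be nonempty bounded open intervals of $\mathbb R$ and let $h>0$. For $y>0$ let $P_y(x)=\frac1\pi\frac{y}{x^2+y^2}$ and $Q_y(x)=\frac1\pi\frac{x}{x^2+y^2}$, let $\widetilde{u}$ denote the extension of $u$ by zero to $\mathbb R$, and let $\mathcal H$ be the Hilbert transform on $L^2(\mathbb R,\mathbb C)$, $\mathcal H u(x)=\frac1\pi\,\mathrm{p.v.}\!\int_{\mathbb R}\frac{u(t)}{x-t}\,dt$ (equivalently, the Fourier multiplier $-i\,\mathrm{sgn}\,\xi$). Define the bounded real-linear operators $$b_2:L^2(S,\mathbb R^2)\to L^2(K),\qquad b_2[(m_1,m_2)]=-\partial_y\big(Q_y\star\widetilde{m_1}+P_y\star\widetilde{m_2}\big)\big|_{K\times\{h\}},$$ $$B_2:L^2(S,\mathbb C)\to L^2(K),\qquad B_2[m]=-\mathrm{Re}\,\partial_x\big(P_h\star(I+i\mathcal H)\widetilde m\big)\big|_{K},$$ $$B_2^*:L^2(K)\to L^2(S,\mathbb C),\qquad B_2^*[\phi]=\partial_x\big(P_h\star(I+i\mathcal H)\widetilde\phi\big)\big|_{S},$$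 and let $b_2^*:L^2(K)\to L^2(S,\mathbb R^2)$ be the adjoint of $b_2$. Let $e_1=(\chi_S,0)$ and $e_2=(0,\chi_S)$ in $L^2(S,\mathbb R^2)$, so that $\int_S m_i=\langle m,e_i\rangle_{L^2(S,\mathbb R^2)}$ for $m=(m_1,m_2)$. **Proposition 3.6.** The ranges of $b_2$, $B_2$, $b_2^*$ and $B_2^*$ are not closed, and none of these four operators is surjective. Hence the moment-estimation problem of minimizing $\|b_2^*[\phi]-e\|_{L^2(S,\mathbb R^2)}$ over $\phi\in L^2(K)$ is ill-posed without a norm constraint (regularization): $e_1,e_2\notin\mathrm{Ran}\,b_2^*$, and for every $e\in L^2(S,\mathbb R^2)\setminus\mathrm{Ran}\,b_2^*$ one has $\inf_{\phi\in L^2(K)}\|b_2^*[\phi]-e\|=0$, so that the infimum is not attained, and every sequence $(\phi_n)$ in $L^2(K)$ with $\|b_2^*[\phi_n]-e\|\to0$ satisfies $\|\phi_n\|_{L^2(K)}\to\infty$. -/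

import Mathlib

open MeasureTheory Set Filter Topology
open scoped ENNReal

noncomputable section

namespace Magnet2D

/-- The Poisson kernel `P_y(x) = (1/π) y / (x² + y²)` of the upper half-plane. -/
def P (y x : ℝ) : ℝ := 1 / Real.pi * (y / (x ^ 2 + y ^ 2))

/-- The conjugate Poisson kernel `Q_y(x) = (1/π) x / (x² + y²)` of the upper half-plane. -/
def Q (y x : ℝ) : ℝ := 1 / Real.pi * (x / (x ^ 2 + y ^ 2))

/-- The convolution `k ⋆ u` of a real kernel with a vector valued function on the line. -/
def conv {E : Type*} [NormedAddCommGroup E] [NormedSpace ℝ E] (k : ℝ → ℝ) (u : ℝ → E) : ℝ → E :=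
  convolution k u (ContinuousLinearMap.lsmul ℝ ℝ) volume

/-- `L²(I, E)` for `I ⊆ ℝ`, with Lebesgue measure. -/
abbrev L2 (I : Set ℝ) (E : Type*) [NormedAddCommGroup E] : Type _ :=
  Lp E 2 (volume.restrict I)

/-- `L²(ℝ, E)`. -/
abbrev L2R (E : Type*) [NormedAddCommGroup E] : Type _ := Lp E 2 (volume : Measure ℝ)

/-! ### Auxiliary estimates -/

theorem conv_apply {E : Type*} [NormedAddCommGroup E] [NormedSpace ℝ E] (k : ℝ → ℝ) (u : ℝ → E)
    (x : ℝ) : conv k u x = ∫ t, k (x - t) • u t :=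
  convolution_lsmul_swap

/-- A majorant of the derivatives of the kernels. -/
def G (h x : ℝ) : ℝ := (x ^ 2 + (h / 2) ^ 2)⁻¹

theorem integrable_G {h : ℝ} (hh : 0 < h) : Integrable (G h) := by
  have h1 := (integrable_inv_one_add_sq.comp_div (R := h / 2) (by positivity)).const_mul
    ((h / 2) ^ 2)⁻¹
  refine h1.congr (Eventually.of_forall fun x => ?_)
  simp only [G]
  field_simp
  ring

theorem G_nonneg (h x : ℝ) : 0 ≤ G h x := by unfold G; positivity

theorem G_le {h : ℝ} (hh : 0 < h) (x : ℝ) : G h x ≤ ((h / 2) ^ 2)⁻¹ := by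
  unfold G
  gcongr
  nlinarith [sq_nonneg x]

theorem measurable_G (h : ℝ) : Measurable (G h) := by unfold G; fun_prop

theorem memLp_of_sq_le {h C : ℝ} (hh : 0 < h) {k : ℝ → ℝ} (hk : Measurable k)
    (hC : ∀ x, k x ^ 2 ≤ C * G h x) : MemLp k 2 volume := by
  rw [memLp_two_iff_integrable_sq hk.aestronglyMeasurable]
  refine ((integrable_G hh).const_mul C).mono' (by fun_prop) (Eventually.of_forall fun x => ?_)
  rw [Real.norm_of_nonneg (sq_nonneg _)]
  exact hC x

theorem memLp_G {h : ℝ} (hh : 0 < h) : MemLp (G h) 2 volume := by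
  refine memLp_of_sq_le hh (measurable_G h) (C := ((h / 2) ^ 2)⁻¹) fun x => ?_
  have := mul_le_mul_of_nonneg_right (G_le hh x) (G_nonneg h x)
  nlinarith

theorem memLp_of_le_G {h : ℝ} (hh : 0 < h) {k : ℝ → ℝ} (hk : Measurable k)
    (hC : ∀ x, |k x| ≤ G h x) : MemLp k 2 volume :=
  (memLp_G hh).mono hk.aestronglyMeasurable
    (Eventually.of_forall fun x => by
      rw [Real.norm_eq_abs, Real.norm_of_nonneg (G_nonneg _ _)]; exact hC x)

theorem measurable_P (y : ℝ) : Measurable (P y) := by unfold P; fun_prop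
theorem measurable_Q (y : ℝ) : Measurable (Q y) := by unfold Q; fun_prop

theorem inv_pi_le_one : 1 / Real.pi ≤ 1 / 2 := by
  have := Real.two_le_pi
  gcongr

theorem memLp_Q {y : ℝ} (hy : 0 < y) : MemLp (Q y) 2 volume := by
  refine memLp_of_sq_le hy (measurable_Q y) (C := 1) fun x => ?_
  have h0 : 0 ≤ 1 / Real.pi := by positivity
  have h1 : (1 / Real.pi) ^ 2 ≤ 1 := by nlinarith [inv_pi_le_one]
  have h2 : (x / (x ^ 2 + y ^ 2)) ^ 2 ≤ G y x := by
    unfold G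
    rw [div_pow, inv_eq_one_div, div_le_div_iff₀ (by positivity) (by positivity)]
    nlinarith [sq_nonneg (x * y), sq_nonneg x, sq_nonneg (y ^ 2)]
  unfold Q
  rw [mul_pow]
  nlinarith [G_nonneg y x, sq_nonneg (x / (x ^ 2 + y ^ 2))]

theorem memLp_P {y : ℝ} (hy : 0 < y) : MemLp (P y) 2 volume := by
  refine memLp_of_sq_le hy (measurable_P y) (C := 1) fun x => ?_
  have h0 : 0 ≤ 1 / Real.pi := by positivity
  have h1 : (1 / Real.pi) ^ 2 ≤ 1 := by nlinarith [inv_pi_le_one]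
  have h2 : (y / (x ^ 2 + y ^ 2)) ^ 2 ≤ G y x := by
    unfold G
    rw [div_pow, inv_eq_one_div, div_le_div_iff₀ (by positivity) (by positivity)]
    nlinarith [sq_nonneg (x * y), sq_nonneg x, sq_nonneg (y ^ 2), sq_nonneg (x ^ 2)]
  unfold P
  rw [mul_pow]
  nlinarith [G_nonneg y x, sq_nonneg (y / (x ^ 2 + y ^ 2))]

/-- `∂_x P_y`, which is also `∂_y Q_y`. -/
def dxP (y x : ℝ) : ℝ := 1 / Real.pi * (-(2 * x * y) / (x ^ 2 + y ^ 2) ^ 2)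

/-- `∂_y P_y`. -/
def dyP (y x : ℝ) : ℝ := 1 / Real.pi * ((x ^ 2 - y ^ 2) / (x ^ 2 + y ^ 2) ^ 2)

theorem measurable_dxP (y : ℝ) : Measurable (dxP y) := by unfold dxP; fun_prop
theorem measurable_dyP (y : ℝ) : Measurable (dyP y) := by unfold dyP; fun_prop

theorem hasDerivAt_P_fst {y : ℝ} (hy : 0 < y) (x : ℝ) :
    HasDerivAt (fun s => P s x) (dyP y x) y := by
  have hD : x ^ 2 + y ^ 2 ≠ 0 := by positivity
  have h1 := ((hasDerivAt_id y).div (((hasDerivAt_id y).pow 2).const_add (x ^ 2)) hD).const_mul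
    (1 / Real.pi)
  refine h1.congr_deriv ?_
  simp only [dyP, id, Pi.pow_apply]
  congr 2
  push_cast
  ring

theorem hasDerivAt_Q_fst {y : ℝ} (hy : 0 < y) (x : ℝ) :
    HasDerivAt (fun s => Q s x) (dxP y x) y := by
  have hD : x ^ 2 + y ^ 2 ≠ 0 := by positivity
  have h1 := ((hasDerivAt_const y x).div (((hasDerivAt_id y).pow 2).const_add (x ^ 2)) hD).const_mul
    (1 / Real.pi)
  refine h1.congr_deriv ?_
  simp only [dxP, id]
  congr 2
  push_cast
  ring

theorem hasDerivAt_P_snd {y : ℝ} (hy : 0 < y) (x : ℝ) :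
    HasDerivAt (fun s => P y s) (dxP y x) x := by
  have hD : x ^ 2 + y ^ 2 ≠ 0 := by positivity
  have h1 := ((hasDerivAt_const x y).div (((hasDerivAt_id x).pow 2).add_const (y ^ 2)) hD).const_mul
    (1 / Real.pi)
  refine h1.congr_deriv ?_
  simp only [dxP, id]
  congr 2
  push_cast
  ring

theorem abs_dxP_le {y : ℝ} (hy : 0 < y) (x : ℝ) : |dxP y x| ≤ 1 / 2 * (x ^ 2 + y ^ 2)⁻¹ := by
  have hD : 0 < x ^ 2 + y ^ 2 := by positivity
  unfold dxP
  rw [abs_mul, abs_of_nonneg (by positivity : 0 ≤ 1 / Real.pi)]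
  refine mul_le_mul inv_pi_le_one ?_ (abs_nonneg _) (by norm_num)
  rw [abs_div, abs_of_pos (by positivity : 0 < (x ^ 2 + y ^ 2) ^ 2), inv_eq_one_div,
    div_le_div_iff₀ (by positivity) hD]
  have : |(-(2 * x * y))| ≤ x ^ 2 + y ^ 2 := by
    rw [abs_le]; constructor <;> nlinarith [sq_nonneg (x - y), sq_nonneg (x + y)]
  nlinarith

theorem abs_dyP_le {y : ℝ} (hy : 0 < y) (x : ℝ) : |dyP y x| ≤ 1 / 2 * (x ^ 2 + y ^ 2)⁻¹ := by
  have hD : 0 < x ^ 2 + y ^ 2 := by positivity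
  unfold dyP
  rw [abs_mul, abs_of_nonneg (by positivity : 0 ≤ 1 / Real.pi)]
  refine mul_le_mul inv_pi_le_one ?_ (abs_nonneg _) (by norm_num)
  rw [abs_div, abs_of_pos (by positivity : 0 < (x ^ 2 + y ^ 2) ^ 2), inv_eq_one_div,
    div_le_div_iff₀ (by positivity) hD]
  have : |x ^ 2 - y ^ 2| ≤ x ^ 2 + y ^ 2 := by
    rw [abs_le]; constructor <;> nlinarith [sq_nonneg x, sq_nonneg y]
  nlinarith

theorem inv_le_G {h y : ℝ} (hh : 0 < h) (hy : h / 2 < y) (x : ℝ) :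
    1 / 2 * (x ^ 2 + y ^ 2)⁻¹ ≤ G h x := by
  have : (x ^ 2 + y ^ 2)⁻¹ ≤ G h x := by
    unfold G
    gcongr
  have := G_nonneg h x
  nlinarith

theorem inv_le_G' {h x x' : ℝ} (hh : 0 < h) (hx : |x' - x| < h / 2) (t : ℝ) :
    1 / 2 * ((x' - t) ^ 2 + h ^ 2)⁻¹ ≤ G h (x - t) := by
  have h1 : (x' - x) ^ 2 < (h / 2) ^ 2 := sq_lt_sq' (by linarith [(abs_lt.1 hx).1]) (abs_lt.1 hx).2
  unfold G
  rw [inv_eq_one_div, inv_eq_one_div, div_mul_div_comm, div_le_div_iff₀ (by positivity)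
    (by positivity)]
  nlinarith [sq_nonneg ((x' - t) + (x' - x))]

section Generic

variable {E : Type*} [NormedAddCommGroup E] [NormedSpace ℝ E]

theorem memLp_shift {k : ℝ → ℝ} (hk : MemLp k 2 volume) (x : ℝ) :
    MemLp (fun t => k (x - t)) 2 volume :=
  hk.comp_measurePreserving (Measure.measurePreserving_sub_left volume x)

theorem integrable_shift_smul {k : ℝ → ℝ} (hk : MemLp k 2 volume) {u : ℝ → E}
    (hu : MemLp u 2 volume) (x : ℝ) : Integrable (fun t => k (x - t) • u t) :=
  memLp_one_iff_integrable.1 (hu.smul (memLp_shift hk x))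

theorem norm_conv_le {k : ℝ → ℝ} (hk : MemLp k 2 volume) (u : L2R E) (x : ℝ) :
    ‖conv k u x‖ ≤ (eLpNorm k 2 volume).toReal * ‖u‖ := by
  rw [conv_apply, Lp.norm_def, ← ENNReal.toReal_mul]
  have h1 : eLpNorm (fun t => k (x - t)) 2 volume = eLpNorm k 2 volume :=
    eLpNorm_comp_measurePreserving hk.1 (Measure.measurePreserving_sub_left volume x)
  have h2 := eLpNorm_smul_le_mul_eLpNorm (p := 2) (q := 2) (r := 1) (Lp.aestronglyMeasurable u)
    (memLp_shift hk x).1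
  rw [h1] at h2
  rw [← toReal_enorm]
  refine ENNReal.toReal_mono (ENNReal.mul_ne_top hk.2.ne (Lp.eLpNorm_ne_top u)) ?_
  refine (enorm_integral_le_lintegral_enorm _).trans ?_
  rwa [eLpNorm_one_eq_lintegral_enorm] at h2

theorem aestronglyMeasurable_conv {k : ℝ → ℝ} (hk : Measurable k) (u : L2R E) (I : Set ℝ) :
    AEStronglyMeasurable (conv k u) (volume.restrict I) := by
  have h0 : AEStronglyMeasurable (fun p : ℝ × ℝ => k (p.1 - p.2) • u p.2)
      (volume.prod volume) := by
    refine AEStronglyMeasurable.smul ?_ (Lp.aestronglyMeasurable u).comp_snd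
    exact (hk.comp (measurable_fst.sub measurable_snd)).aestronglyMeasurable
  have h1 := h0.integral_prod_right'
  have h2 : conv k u = fun x => ∫ t, k (x - t) • u t := funext fun x => conv_apply k u x
  rw [h2]
  exact h1.mono_measure Measure.restrict_le_self

/-- Differentiation of a parameter dependent family of convolutions under the integral sign. -/
theorem hasDerivAt_param {h : ℝ} (hh : 0 < h) {k k' : ℝ → ℝ → ℝ} {u : ℝ → E}
    (hu : MemLp u 2 volume) (x s₀ : ℝ)
    (hk : ∀ s, Measurable (k s)) (hk0 : MemLp (k s₀) 2 volume) (hk' : Measurable (k' s₀))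
    (hb : ∀ s ∈ Metric.ball s₀ (h / 2), ∀ t, |k' s t| ≤ G h (x - t))
    (hd : ∀ s ∈ Metric.ball s₀ (h / 2), ∀ t, HasDerivAt (fun s => k s t) (k' s t) s) :
    HasDerivAt (fun s => ∫ t, k s t • u t) (∫ t, k' s₀ t • u t) s₀ := by
  refine (hasDerivAt_integral_of_dominated_loc_of_deriv_le (μ := volume)
    (F := fun s t => k s t • u t) (F' := fun s t => k' s t • u t)
    (bound := fun t => G h (x - t) * ‖u t‖)
    (Metric.ball_mem_nhds s₀ (half_pos hh)) (Eventually.of_forall fun s => ?_) ?_ ?_ ?_ ?_ ?_).2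
  · exact (hk s).aestronglyMeasurable.smul hu.1
  · exact memLp_one_iff_integrable.1 (hu.smul hk0)
  · exact hk'.aestronglyMeasurable.smul hu.1
  · refine Eventually.of_forall fun t s hs => ?_
    rw [norm_smul, Real.norm_eq_abs]
    exact mul_le_mul_of_nonneg_right (hb s hs t) (norm_nonneg _)
  · exact integrable_shift_smul (memLp_G hh) hu.norm x
  · exact Eventually.of_forall fun t s hs => (hd s hs t).smul_const (u t)

theorem hasDerivAt_conv_P_fst {h : ℝ} (hh : 0 < h) {u : ℝ → E} (hu : MemLp u 2 volume) (x : ℝ) :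
    HasDerivAt (fun y => conv (P y) u x) (conv (dyP h) u x) h := by
  simp only [conv_apply]
  have hpos : ∀ s ∈ Metric.ball h (h / 2), h / 2 < s := fun s hs => by
    rw [Metric.mem_ball, Real.dist_eq, abs_lt] at hs; linarith [hs.1]
  exact hasDerivAt_param hh (k := fun s t => P s (x - t)) (k' := fun s t => dyP s (x - t)) hu x h
    (fun s => (measurable_P s).comp (by fun_prop)) (memLp_shift (memLp_P hh) x)
    ((measurable_dyP h).comp (by fun_prop))
    (fun s hs t => (abs_dyP_le (by linarith [hpos s hs]) _).trans (inv_le_G hh (hpos s hs) _))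
    (fun s hs t => hasDerivAt_P_fst (by linarith [hpos s hs]) _)

theorem hasDerivAt_conv_Q_fst {h : ℝ} (hh : 0 < h) {u : ℝ → E} (hu : MemLp u 2 volume) (x : ℝ) :
    HasDerivAt (fun y => conv (Q y) u x) (conv (dxP h) u x) h := by
  simp only [conv_apply]
  have hpos : ∀ s ∈ Metric.ball h (h / 2), h / 2 < s := fun s hs => by
    rw [Metric.mem_ball, Real.dist_eq, abs_lt] at hs; linarith [hs.1]
  exact hasDerivAt_param hh (k := fun s t => Q s (x - t)) (k' := fun s t => dxP s (x - t)) hu x h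
    (fun s => (measurable_Q s).comp (by fun_prop)) (memLp_shift (memLp_Q hh) x)
    ((measurable_dxP h).comp (by fun_prop))
    (fun s hs t => (abs_dxP_le (by linarith [hpos s hs]) _).trans (inv_le_G hh (hpos s hs) _))
    (fun s hs t => hasDerivAt_Q_fst (by linarith [hpos s hs]) _)

theorem hasDerivAt_conv_P_snd {h : ℝ} (hh : 0 < h) {u : ℝ → E} (hu : MemLp u 2 volume) (x : ℝ) :
    HasDerivAt (conv (P h) u) (conv (dxP h) u x) x := by
  have h2 : conv (P h) u = fun x => ∫ t, P h (x - t) • u t := funext fun x => conv_apply _ u x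
  rw [h2, conv_apply]
  exact hasDerivAt_param hh (k := fun s t => P h (s - t)) (k' := fun s t => dxP h (s - t)) hu x x
    (fun s => (measurable_P h).comp (by fun_prop)) (memLp_shift (memLp_P hh) x)
    ((measurable_dxP h).comp (by fun_prop))
    (fun s hs t => (abs_dxP_le hh _).trans (inv_le_G' hh (by simpa [Real.dist_eq] using hs) t))
    (fun s hs t => (hasDerivAt_P_snd hh (s - t)).comp_sub_const s t)

theorem memLp_dxP {h : ℝ} (hh : 0 < h) : MemLp (dxP h) 2 volume :=
  memLp_of_le_G hh (measurable_dxP h) fun x =>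
    (abs_dxP_le hh x).trans (inv_le_G hh (by linarith) x)

theorem memLp_dyP {h : ℝ} (hh : 0 < h) : MemLp (dyP h) 2 volume :=
  memLp_of_le_G hh (measurable_dyP h) fun x =>
    (abs_dyP_le hh x).trans (inv_le_G hh (by linarith) x)

theorem conv_congr (k : ℝ → ℝ) {u v : ℝ → E} (huv : u =ᵐ[volume] v) : conv k u = conv k v := by
  funext x
  rw [conv_apply, conv_apply]
  exact integral_congr_ae (huv.mono fun t ht => by simp only [ht])

theorem conv_add {k : ℝ → ℝ} (hk : MemLp k 2 volume) {u v : ℝ → E} (hu : MemLp u 2 volume)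
    (hv : MemLp v 2 volume) (x : ℝ) :
    conv k (fun t => u t + v t) x = conv k u x + conv k v x := by
  simp only [conv_apply, smul_add]
  exact integral_add (integrable_shift_smul hk hu x) (integrable_shift_smul hk hv x)

theorem conv_smul {𝕜 : Type*} [RCLike 𝕜] [NormedSpace 𝕜 E] [SMulCommClass ℝ 𝕜 E] (k : ℝ → ℝ)
    (c : 𝕜) (u : ℝ → E) (x : ℝ) : conv k (fun t => c • u t) x = c • conv k u x := by
  simp only [conv_apply]
  rw [← integral_smul]
  exact integral_congr_ae (Eventually.of_forall fun t => smul_comm _ _ _)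

end Generic

/-! ### Building operators into `L²` of a bounded interval -/

/-- A linear operator `T` from a normed space to functions on `ℝ`, with values measurable and
pointwise bounded by `C ‖u‖`, followed by restriction to the interval `(a, b)`. -/
def toL2 {𝕜 X F : Type*} [NontriviallyNormedField 𝕜] [NormedAddCommGroup X] [NormedSpace 𝕜 X]
    [NormedAddCommGroup F] [NormedSpace 𝕜 F] (a b : ℝ) (T : X →ₗ[𝕜] (ℝ → F))
    (hT : ∀ u, AEStronglyMeasurable (T u) (volume.restrict (Ioo a b))) (C : ℝ)
    (hC : ∀ u x, ‖T u x‖ ≤ C * ‖u‖) : X →L[𝕜] L2 (Ioo a b) F :=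
  LinearMap.mkContinuous
    { toFun := fun u =>
        (MemLp.of_bound (hT u) (C * ‖u‖) (Eventually.of_forall (hC u))).toLp (T u)
      map_add' := fun u v => by
        rw [← MemLp.toLp_add]
        exact MemLp.toLp_congr _ _ (Eventually.of_forall fun x => by rw [map_add])
      map_smul' := fun c u => by
        rw [RingHom.id_apply, ← MemLp.toLp_const_smul]
        exact MemLp.toLp_congr _ _ (Eventually.of_forall fun x => by rw [map_smul]) }
    (measureUnivNNReal (volume.restrict (Ioo a b)) ^ (2 : ℝ≥0∞).toReal⁻¹ * C)
    (fun u => by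
      rw [mul_assoc]
      refine Lp.norm_le_of_ae_bound ((norm_nonneg _).trans (hC u 0)) ?_
      filter_upwards [MemLp.coeFn_toLp
        (MemLp.of_bound (p := 2) (hT u) (C * ‖u‖) (Eventually.of_forall (hC u)))] with x hx
      simp only [LinearMap.coe_mk, AddHom.coe_mk]
      rw [hx]
      exact hC u x)

/-- Extension by zero, `φ ↦ φ̃`, from `L²((a, b), E)` to `L²(ℝ, E)`. -/
def ext (𝕜 : Type*) {E : Type*} [NontriviallyNormedField 𝕜] [NormedAddCommGroup E]
    [NormedSpace 𝕜 E] (a b : ℝ) : L2 (Ioo a b) E →L[𝕜] L2R E :=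
  LinearMap.mkContinuous
    { toFun := fun u =>
        ((memLp_indicator_iff_restrict measurableSet_Ioo).2 (Lp.memLp u)).toLp
          ((Ioo a b).indicator u)
      map_add' := fun u v => by
        rw [← MemLp.toLp_add]
        refine MemLp.toLp_congr _ _ ?_
        rw [← indicator_add']
        exact (ae_eq_restrict_iff_indicator_ae_eq measurableSet_Ioo).1 (Lp.coeFn_add u v)
      map_smul' := fun c u => by
        rw [RingHom.id_apply, ← MemLp.toLp_const_smul]
        refine MemLp.toLp_congr _ _ ?_
        have := (ae_eq_restrict_iff_indicator_ae_eq measurableSet_Ioo).1 (Lp.coeFn_smul c u)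
        refine this.trans (Eventually.of_forall fun x => ?_)
        rw [Pi.smul_apply]
        by_cases hx : x ∈ Ioo a b <;> simp [hx] }
    1
    (fun u => by
      simp only [LinearMap.coe_mk, AddHom.coe_mk]
      rw [one_mul, Lp.norm_toLp, eLpNorm_indicator_eq_eLpNorm_restrict measurableSet_Ioo,
        Lp.norm_def])

/-! ### The operators -/

/-- The Fourier symbol `ξ ↦ -i sgn ξ` of the Hilbert transform, as a bounded function. -/
def hilbertSymbol : Lp ℂ ∞ (volume : Measure ℝ) :=
  MemLp.toLp (fun ξ : ℝ => -Complex.I * (Real.sign ξ : ℂ)) <| by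
    refine memLp_top_of_bound ?_ 1 (Eventually.of_forall fun ξ => ?_)
    · have h1 : Measurable Real.sign := by
        unfold Real.sign
        exact Measurable.ite measurableSet_Iio measurable_const
          (Measurable.ite measurableSet_Ioi measurable_const measurable_const)
      exact (Complex.measurable_ofReal.comp h1 |>.const_mul _).aestronglyMeasurable
    · rcases Real.sign_apply_eq ξ with h | h | h <;> simp [h]

/-- The Hilbert transform `ℋ u(x) = (1/π) p.v. ∫ u(t) / (x - t) dt` on `L²(ℝ, ℂ)`, i.e. the
operator with Fourier multiplier `-i sgn ξ` (for the Fourier transform `∫ e^{-2πi x ξ} u(x) dx`). -/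
def hilbert : L2R ℂ →L[ℂ] L2R ℂ :=
  (Lp.fourierTransformₗᵢ ℝ ℂ).symm.toContinuousLinearEquiv.toContinuousLinearMap ∘L
    (ContinuousLinearMap.mul ℂ ℂ).holderL volume ∞ 2 2 hilbertSymbol ∘L
      (Lp.fourierTransformₗᵢ ℝ ℂ).toContinuousLinearEquiv.toContinuousLinearMap

/-- A component of a vector field is again in `L²`. -/
theorem memLp_coord (u : L2R (EuclideanSpace ℝ (Fin 2))) (i : Fin 2) :
    MemLp (fun t => u t i) 2 (volume : Measure ℝ) :=
  (EuclideanSpace.proj (𝕜 := ℝ) i).comp_memLp' (Lp.memLp u)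

theorem norm_coord_le (u : L2R (EuclideanSpace ℝ (Fin 2))) (i : Fin 2) :
    ‖(memLp_coord u i).toLp‖ ≤ ‖u‖ := by
  refine Lp.norm_le_norm_of_ae_le ?_
  filter_upwards [(memLp_coord u i).coeFn_toLp] with t ht
  rw [ht]
  exact PiLp.norm_apply_le (u t) i

theorem conv_coord (k : ℝ → ℝ) (u : L2R (EuclideanSpace ℝ (Fin 2))) (i : Fin 2) :
    conv k (fun t => u t i) = conv k (memLp_coord u i).toLp :=
  conv_congr k (memLp_coord u i).coeFn_toLp.symm

theorem deriv_field {h : ℝ} (hh : 0 < h) (u : L2R (EuclideanSpace ℝ (Fin 2))) (x : ℝ) :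
    deriv (fun y => conv (Q y) (fun t => u t 0) x + conv (P y) (fun t => u t 1) x) h =
      conv (dxP h) (fun t => u t 0) x + conv (dyP h) (fun t => u t 1) x :=
  ((hasDerivAt_conv_Q_fst hh (memLp_coord u 0) x).add
    (hasDerivAt_conv_P_fst hh (memLp_coord u 1) x)).deriv

/-- `(u₁, u₂) ↦ -∂_y (Q_y ⋆ u₁ + P_y ⋆ u₂) (x)` at `y = h`, as a function of `x ∈ ℝ`. -/
def fieldFun {h : ℝ} (hh : 0 < h) : L2R (EuclideanSpace ℝ (Fin 2)) →ₗ[ℝ] (ℝ → ℝ) where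
  toFun u x := -deriv (fun y => conv (Q y) (fun t => u t 0) x + conv (P y) (fun t => u t 1) x) h
  map_add' u v := by
    funext x
    have e : ∀ i : Fin 2, (fun t => (u + v) t i) =ᵐ[volume] fun t => u t i + v t i := fun i =>
      (Lp.coeFn_add u v).mono fun t ht => by beta_reduce; rw [ht]; rfl
    simp only [deriv_field hh, Pi.add_apply]
    rw [conv_congr _ (e 0), conv_congr _ (e 1),
      conv_add (memLp_dxP hh) (memLp_coord u 0) (memLp_coord v 0),
      conv_add (memLp_dyP hh) (memLp_coord u 1) (memLp_coord v 1)]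
    ring
  map_smul' c u := by
    funext x
    have e : ∀ i : Fin 2, (fun t => (c • u) t i) =ᵐ[volume] fun t => c • u t i := fun i =>
      (Lp.coeFn_smul c u).mono fun t ht => by beta_reduce; rw [ht]; rfl
    simp only [deriv_field hh, Pi.smul_apply, RingHom.id_apply]
    rw [conv_congr _ (e 0), conv_congr _ (e 1), conv_smul, conv_smul]
    simp only [smul_eq_mul]
    ring

theorem fieldFun_measurable {h : ℝ} (hh : 0 < h) (a b : ℝ) (u : L2R (EuclideanSpace ℝ (Fin 2))) :
    AEStronglyMeasurable (fieldFun hh u) (volume.restrict (Ioo a b)) := by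
  have e : (fieldFun hh u : ℝ → ℝ) = fun x =>
      -(conv (dxP h) (memLp_coord u 0).toLp x + conv (dyP h) (memLp_coord u 1).toLp x) := by
    funext x
    rw [← conv_coord, ← conv_coord, ← deriv_field hh]
    rfl
  rw [e]
  exact ((aestronglyMeasurable_conv (measurable_dxP h) _ _).add
    (aestronglyMeasurable_conv (measurable_dyP h) _ _)).neg

theorem fieldFun_bound {h : ℝ} (hh : 0 < h) (u : L2R (EuclideanSpace ℝ (Fin 2))) (x : ℝ) :
    ‖fieldFun hh u x‖ ≤
      ((eLpNorm (dxP h) 2 volume).toReal + (eLpNorm (dyP h) 2 volume).toReal) * ‖u‖ := by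
  have e : fieldFun hh u x =
      -(conv (dxP h) (memLp_coord u 0).toLp x + conv (dyP h) (memLp_coord u 1).toLp x) := by
    rw [← conv_coord, ← conv_coord, ← deriv_field hh]
    rfl
  rw [e, norm_neg, add_mul]
  refine (norm_add_le _ _).trans (add_le_add ?_ ?_)
  · exact (norm_conv_le (memLp_dxP hh) _ x).trans
      (mul_le_mul_of_nonneg_left (norm_coord_le u 0) ENNReal.toReal_nonneg)
  · exact (norm_conv_le (memLp_dyP hh) _ x).trans
      (mul_le_mul_of_nonneg_left (norm_coord_le u 1) ENNReal.toReal_nonneg)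

/-- The magnetization-to-field operator `b₂ : L²(S, ℝ²) → L²(K)` at height `h`, for `S = (a, b)`
and `K = (c, d)`: `b₂[m] = -∂_y (Q_y ⋆ m̃₁ + P_y ⋆ m̃₂)` restricted to `K × {h}`. -/
def b₂ {h : ℝ} (hh : 0 < h) (a b c d : ℝ) :
    L2 (Ioo a b) (EuclideanSpace ℝ (Fin 2)) →L[ℝ] L2 (Ioo c d) ℝ :=
  toL2 c d (fieldFun hh) (fieldFun_measurable hh c d) _ (fieldFun_bound hh) ∘L ext ℝ a b

/-- The adjoint `b₂* : L²(K) → L²(S, ℝ²)` of `b₂`. -/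
def b₂star {h : ℝ} (hh : 0 < h) (a b c d : ℝ) :
    L2 (Ioo c d) ℝ →L[ℝ] L2 (Ioo a b) (EuclideanSpace ℝ (Fin 2)) :=
  ContinuousLinearMap.adjoint (b₂ hh a b c d)

/-- `u ↦ ∂_x (P_h ⋆ u)`, with values in functions on `ℝ`. -/
def dPoissonFun {h : ℝ} (hh : 0 < h) : L2R ℂ →ₗ[ℂ] (ℝ → ℂ) where
  toFun u x := deriv (conv (P h) u) x
  map_add' u v := by
    funext x
    simp only [Pi.add_apply]
    rw [(hasDerivAt_conv_P_snd hh (Lp.memLp _) x).deriv,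
      (hasDerivAt_conv_P_snd hh (Lp.memLp _) x).deriv,
      (hasDerivAt_conv_P_snd hh (Lp.memLp _) x).deriv, conv_congr _ (Lp.coeFn_add u v)]
    exact conv_add (memLp_dxP hh) (Lp.memLp u) (Lp.memLp v) x
  map_smul' c u := by
    funext x
    simp only [Pi.smul_apply, RingHom.id_apply]
    rw [(hasDerivAt_conv_P_snd hh (Lp.memLp _) x).deriv,
      (hasDerivAt_conv_P_snd hh (Lp.memLp _) x).deriv, conv_congr _ (Lp.coeFn_smul c u)]
    exact conv_smul _ c u x

theorem dPoissonFun_measurable {h : ℝ} (hh : 0 < h) (a b : ℝ) (u : L2R ℂ) :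
    AEStronglyMeasurable (dPoissonFun hh u) (volume.restrict (Ioo a b)) := by
  have e : (dPoissonFun hh u : ℝ → ℂ) = conv (dxP h) u :=
    funext fun x => (hasDerivAt_conv_P_snd hh (Lp.memLp u) x).deriv
  rw [e]
  exact aestronglyMeasurable_conv (measurable_dxP h) u _

theorem dPoissonFun_bound {h : ℝ} (hh : 0 < h) (u : L2R ℂ) (x : ℝ) :
    ‖dPoissonFun hh u x‖ ≤ (eLpNorm (dxP h) 2 volume).toReal * ‖u‖ := by
  have e : dPoissonFun hh u x = conv (dxP h) u x :=
    (hasDerivAt_conv_P_snd hh (Lp.memLp u) x).deriv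
  rw [e]
  exact norm_conv_le (memLp_dxP hh) u x

/-- `u ↦ ∂_x (P_h ⋆ u)` restricted to `(a, b)`, from `L²(ℝ, ℂ)` to `L²((a, b), ℂ)`. -/
def dPoisson {h : ℝ} (hh : 0 < h) (a b : ℝ) : L2R ℂ →L[ℂ] L2 (Ioo a b) ℂ :=
  toL2 a b (dPoissonFun hh) (dPoissonFun_measurable hh a b) _ (dPoissonFun_bound hh)

/-- The analytic version `B₂ : L²(S, ℂ) → L²(K)` of `b₂`:
`B₂[m] = -Re ∂_x (P_h ⋆ (I + i ℋ) m̃)` restricted to `K`. -/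
def B₂ {h : ℝ} (hh : 0 < h) (a b c d : ℝ) : L2 (Ioo a b) ℂ →L[ℝ] L2 (Ioo c d) ℝ :=
  -(Complex.reCLM.compLpL 2 (volume.restrict (Ioo c d)) ∘L
    (dPoisson hh c d ∘L (ContinuousLinearMap.id ℂ (L2R ℂ) + Complex.I • hilbert) ∘L
      ext ℂ a b).restrictScalars ℝ)

/-- The analytic version `B₂* : L²(K) → L²(S, ℂ)` of `b₂*`:
`B₂*[φ] = ∂_x (P_h ⋆ (I + i ℋ) φ̃)` restricted to `S`. -/
def B₂star {h : ℝ} (hh : 0 < h) (a b c d : ℝ) : L2 (Ioo c d) ℝ →L[ℝ] L2 (Ioo a b) ℂ :=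
  (dPoisson hh a b ∘L (ContinuousLinearMap.id ℂ (L2R ℂ) + Complex.I • hilbert) ∘L
      ext ℂ c d).restrictScalars ℝ ∘L
    Complex.ofRealCLM.compLpL 2 (volume.restrict (Ioo c d))

/-- The vector field `e₁ = (χ_S, 0)` (for `i = 0`) or `e₂ = (0, χ_S)` (for `i = 1`) in
`L²(S, ℝ²)`, `S = (a, b)`; the moment `⟨mᵢ⟩ = ∫_S mᵢ` is the inner product of `m` with it. -/
def momentVec (a b : ℝ) (i : Fin 2) : L2 (Ioo a b) (EuclideanSpace ℝ (Fin 2)) :=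
  Lp.const 2 (volume.restrict (Ioo a b)) (EuclideanSpace.single i 1)

end Magnet2D

end

/-! All four operators come from one holomorphic object. The multiplier of `I + iℋ` is `1 + sgn ξ`,
so it keeps only positive frequencies. Hence `∂_x P_h ⋆ (I + iℋ)u` is the Cauchy type integral
`-(i/π) ∫ u(t) (z - t)⁻² dt` on the line `Im z = h` (`conv_dxP_analytic`). Under `ℝ² ≅ ℂ`, `b₂` is
minus its real part and `b₂*` is the full complex field of a real source (`B₂_toComplex`,
`b₂star_apply`).

Everything then rests on a rigidity statement, `analyticField_rigid`. Let `Re(β · field)` equal a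
constant `r` on an interval, with `β ≠ 0`. Real analyticity spreads this to the whole line, and
decay at infinity forces `r = 0`. Schwarz reflection, Liouville and decay make the Cauchy integral
vanish on `Im z ≥ h`, and the identity theorem extends this to the upper half-plane. Integrating
once in `z` and expanding along the imaginary axis kills every moment of `u`. A source of bounded
support then vanishes by Weierstrass approximation.

The conclusion `u = 0` makes `b₂` and `b₂*` injective, so each has dense range, being the adjoint of
the other; this passes to `B₂` and `B₂*`. The conclusion `r = 0` excludes nonzero constants, in
particular `e₁` and `e₂`, from the ranges. A dense proper range is not closed, and distances to it
are zero. Finally, a minimizing sequence that is bounded along a subsequence would have a weak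
cluster point solving the equation exactly (`tendsto_norm_atTop_of_notMem_range`). -/

namespace Magnet2D

/-! ### Cauchy type integrals on the upper half-plane and the moments of their density. -/

/-- The Cauchy type integral `∫ u(t) / (z - t)ⁿ dt`. -/
noncomputable def cauchyPow (n : ℕ) (u : ℝ → ℂ) (z : ℂ) : ℂ := ∫ t : ℝ, ((z - t) ^ n)⁻¹ * u t

theorem norm_inv_sub_pow_le (n : ℕ) {z : ℂ} {y : ℝ} (hy : 0 < y) (hz : y ≤ z.im) (t : ℝ) :
    ‖((z - t) ^ n)⁻¹‖ ≤ (y ^ n)⁻¹ := by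
  rw [norm_inv, norm_pow]
  have h1 : y ≤ ‖z - t‖ := by
    have h2 := Complex.abs_im_le_norm (z - t)
    simp only [Complex.sub_im, Complex.ofReal_im, sub_zero] at h2
    exact (hz.trans (le_abs_self _)).trans h2
  gcongr

theorem sub_ofReal_ne_zero {z : ℂ} (hz : 0 < z.im) (t : ℝ) : z - t ≠ 0 := by
  intro h
  have := congrArg Complex.im h
  simp at this
  exact hz.ne' this

theorem measurable_inv_sub_pow (n : ℕ) (z : ℂ) : Measurable fun t : ℝ => ((z - t) ^ n)⁻¹ := by
  fun_prop

theorem integrable_cauchyPow (n : ℕ) {u : ℝ → ℂ} (hu : Integrable u) {z : ℂ} (hz : 0 < z.im) :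
    Integrable fun t : ℝ => ((z - t) ^ n)⁻¹ * u t :=
  hu.bdd_mul (measurable_inv_sub_pow n z).aestronglyMeasurable
    (Eventually.of_forall fun t => norm_inv_sub_pow_le n hz le_rfl t)

theorem norm_cauchyPow_le (n : ℕ) {u : ℝ → ℂ} (hu : Integrable u) {z : ℂ} {y : ℝ} (hy : 0 < y)
    (hz : y ≤ z.im) : ‖cauchyPow n u z‖ ≤ (y ^ n)⁻¹ * ∫ t, ‖u t‖ := by
  rw [← integral_const_mul]
  refine norm_integral_le_of_norm_le (hu.norm.const_mul _) (Eventually.of_forall fun t => ?_)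
  rw [norm_mul]
  exact mul_le_mul_of_nonneg_right (norm_inv_sub_pow_le n hy hz t) (norm_nonneg _)

theorem hasDerivAt_cauchyPow (n : ℕ) {u : ℝ → ℂ} (hu : Integrable u) {z : ℂ} (hz : 0 < z.im) :
    HasDerivAt (cauchyPow n u) (-n * cauchyPow (n + 1) u z) z := by
  -- On this ball the distance to the real line stays at least `Im z / 2`, which gives a dominating
  -- function independent of `w`.
  have him : ∀ w ∈ Metric.ball z (z.im / 2), z.im / 2 ≤ w.im := fun w hw => by
    have h1 := (Complex.abs_im_le_norm (w - z)).trans_lt (mem_ball_iff_norm.1 hw)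
    rw [Complex.sub_im, abs_lt] at h1
    linarith [h1.1]
  have key := (hasDerivAt_integral_of_dominated_loc_of_deriv_le (μ := volume)
    (F := fun (w : ℂ) (t : ℝ) => ((w - t) ^ n)⁻¹ * u t)
    (F' := fun (w : ℂ) (t : ℝ) => -n * (((w - t) ^ (n + 1))⁻¹ * u t))
    (bound := fun t => n * (((z.im / 2) ^ (n + 1))⁻¹ * ‖u t‖))
    (Metric.ball_mem_nhds z (half_pos hz)) (Eventually.of_forall fun w => ?_)
    (integrable_cauchyPow n hu hz) ?_ ?_ ?_ ?_).2
  · rw [integral_const_mul] at key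
    exact key
  · exact (measurable_inv_sub_pow n w).aestronglyMeasurable.mul hu.1
  · exact ((measurable_inv_sub_pow (n + 1) z).aestronglyMeasurable.mul hu.1).const_mul _
  · refine Eventually.of_forall fun t w hw => ?_
    rw [norm_mul, norm_mul, norm_neg, Complex.norm_natCast]
    have := norm_inv_sub_pow_le (n + 1) (half_pos hz) (him w hw) t
    gcongr
  · exact (hu.norm.const_mul _).const_mul _
  · refine Eventually.of_forall fun t w hw => ?_
    have hne := sub_ofReal_ne_zero ((half_pos hz).trans_le (him w hw)) t
    have h1 := ((((hasDerivAt_id w).sub_const (t : ℂ)).pow n).inv (pow_ne_zero n hne)).mul_const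
      (u t)
    refine h1.congr_deriv ?_
    simp only [id]
    -- The power rule produces the truncated exponent `n - 1`, so `n = 0` is separate.
    rcases n with _ | n
    · simp
    · simp only [Pi.pow_apply, Nat.add_sub_cancel, mul_one]
      push_cast
      field_simp
      ring

/-- Dominated convergence: on a fixed horizontal line the kernel is bounded and tends to zero
pointwise. The exponent `n + 1` excludes the constant kernel, which does not decay. -/
theorem tendsto_cauchyPow_zero (n : ℕ) {u : ℝ → ℂ} (hu : Integrable u) {y : ℝ} (hy : 0 < y) :
    Tendsto (fun x : ℝ => cauchyPow (n + 1) u (x + y * Complex.I)) atTop (𝓝 0) := by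
  have h0 : (0 : ℂ) = ∫ t : ℝ, (0 : ℂ) := by simp
  rw [h0]
  refine tendsto_integral_filter_of_dominated_convergence
    (fun t => (y ^ (n + 1))⁻¹ * ‖u t‖) (Eventually.of_forall fun x => ?_)
    (Eventually.of_forall fun x => Eventually.of_forall fun t => ?_) (hu.norm.const_mul _)
    (Eventually.of_forall fun t => ?_)
  · exact (measurable_inv_sub_pow (n + 1) _).aestronglyMeasurable.mul hu.1
  · rw [norm_mul]
    exact mul_le_mul_of_nonneg_right (norm_inv_sub_pow_le _ hy (by simp) t) (norm_nonneg _)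
  · rw [← zero_mul (u t)]
    refine Tendsto.mul_const _ (tendsto_inv₀_cobounded.comp ?_)
    rw [← tendsto_norm_atTop_iff_cobounded]
    simp only [norm_pow]
    refine (tendsto_pow_atTop n.succ_ne_zero).comp ?_
    refine tendsto_atTop_mono (f := fun x : ℝ => x - t) (fun x => ?_)
      (tendsto_atTop_add_const_right _ (-t) tendsto_id)
    have := Complex.re_le_norm (x + y * Complex.I - t)
    simpa using this

theorem tendsto_cauchyPow_one_zero {u : ℝ → ℂ} (hu : Integrable u) :
    Tendsto (fun y : ℝ => cauchyPow 1 u (y * Complex.I)) atTop (𝓝 0) := by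
  have h1 : Tendsto (fun y : ℝ => (y ^ 1)⁻¹ * ∫ t, ‖u t‖) atTop (𝓝 0) := by
    simpa using tendsto_inv_atTop_zero.mul_const (∫ t, ‖u t‖)
  refine squeeze_zero_norm' ?_ h1
  filter_upwards [eventually_gt_atTop 0] with y hy
  exact norm_cauchyPow_le 1 hu hy (by simp)

/-- The second-order integral is, up to sign, the derivative of the first-order one, which is
therefore constant on the connected half-plane. Decay along the imaginary axis makes the constant
zero. -/
theorem cauchyPow_one_eq_zero {u : ℝ → ℂ} (hu : Integrable u)
    (h : ∀ z : ℂ, 0 < z.im → cauchyPow 2 u z = 0) {z : ℂ} (hz : 0 < z.im) :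
    cauchyPow 1 u z = 0 := by
  have hopen : IsOpen {z : ℂ | 0 < z.im} := isOpen_lt continuous_const Complex.continuous_im
  have hd : ∀ z : ℂ, 0 < z.im → HasDerivAt (cauchyPow 1 u) 0 z := fun z hz =>
    (hasDerivAt_cauchyPow 1 hu hz).congr_deriv (by rw [h z hz, mul_zero])
  have hconst : ∀ y : ℝ, 0 < y → cauchyPow 1 u (y * Complex.I) = cauchyPow 1 u z := fun y hy =>
    hopen.is_const_of_deriv_eq_zero (convex_halfSpace_im_gt 0).isPreconnected
      (fun w hw => (hd w hw).differentiableAt.differentiableWithinAt)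
      (fun w hw => (hd w hw).deriv) (by simpa using hy) hz
  refine tendsto_nhds_unique (tendsto_const_nhds.congr' ?_) (tendsto_cauchyPow_one_zero hu)
  filter_upwards [eventually_gt_atTop 0] with y hy
  exact (hconst y hy).symm

/-- The leading term at infinity is the total mass: `z / (z - t) → 1` along `z = iy`, and its
modulus is at most `1` there. -/
theorem integral_eq_zero_of_cauchyPow_one {u : ℝ → ℂ} (hu : Integrable u)
    (h : ∀ z : ℂ, 0 < z.im → cauchyPow 1 u z = 0) : ∫ t, u t = 0 := by
  have hlim : Tendsto (fun y : ℝ => ∫ t : ℝ, y * Complex.I * (((y * Complex.I - t) ^ 1)⁻¹ * u t))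
      atTop (𝓝 (∫ t, u t)) := by
    refine tendsto_integral_filter_of_dominated_convergence (fun t => ‖u t‖)
      (Eventually.of_forall fun y => ?_) ?_ hu.norm (Eventually.of_forall fun t => ?_)
    · exact ((measurable_inv_sub_pow 1 _).aestronglyMeasurable.mul hu.1).const_mul _
    · filter_upwards [eventually_gt_atTop 0] with y hy
      refine Eventually.of_forall fun t => ?_
      have h1 := norm_inv_sub_pow_le 1 (z := y * Complex.I) hy (by simp) t
      rw [norm_mul, norm_mul, norm_mul, Complex.norm_I, mul_one, Complex.norm_real,
        Real.norm_of_nonneg hy.le, ← mul_assoc]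
      refine mul_le_of_le_one_left (norm_nonneg _) ?_
      calc y * ‖((y * Complex.I - t) ^ 1)⁻¹‖ ≤ y * (y ^ 1)⁻¹ := by gcongr
        _ = 1 := by field_simp
    · have h1 : Tendsto (fun y : ℝ => (1 - (t : ℂ) * (y * Complex.I)⁻¹)⁻¹ * u t) atTop
          (𝓝 ((1 - (t : ℂ) * 0)⁻¹ * u t)) := by
        refine Tendsto.mul_const _ (Tendsto.inv₀ ?_ (by simp))
        refine Tendsto.sub tendsto_const_nhds (Tendsto.const_mul _ (tendsto_inv₀_cobounded.comp ?_))
        rw [← tendsto_norm_atTop_iff_cobounded]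
        simpa using tendsto_abs_atTop_atTop
      simp only [mul_zero, sub_zero, inv_one, one_mul] at h1
      refine h1.congr' ?_
      filter_upwards [eventually_gt_atTop 0] with y hy
      have h2 : (y : ℂ) * Complex.I ≠ 0 := by simp [hy.ne']
      have h3 : (y : ℂ) * Complex.I - t ≠ 0 := sub_ofReal_ne_zero (by simpa using hy) t
      rw [pow_one, ← mul_assoc]
      congr 1
      rw [inv_eq_iff_eq_inv, mul_inv _ (_ - _)⁻¹, inv_inv]
      have hy' : (y : ℂ) ≠ 0 := by simpa using hy.ne'
      field_simp
  refine tendsto_nhds_unique hlim (tendsto_const_nhds.congr' ?_)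
  filter_upwards [eventually_gt_atTop 0] with y hy
  rw [integral_const_mul, ← cauchyPow, h _ (by simpa using hy), mul_zero]

theorem integrable_ofReal_mul {u : ℝ → ℂ} (hu : Integrable u) {R : ℝ}
    (hs : ∀ t, R < |t| → u t = 0) : Integrable fun t : ℝ => (t : ℂ) * u t := by
  refine (hu.norm.const_mul R).mono'
    (Complex.measurable_ofReal.aestronglyMeasurable.mul hu.1) (Eventually.of_forall fun t => ?_)
  rw [norm_mul, Complex.norm_real, Real.norm_eq_abs]
  by_cases ht : R < |t|
  · simp [hs t ht]
  · exact mul_le_mul_of_nonneg_right (not_lt.1 ht) (norm_nonneg _)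

/-- Since `t / (z - t) = z / (z - t) - 1`, the Cauchy integral of `t u(t)` is `z` times that of `u`
minus the mass of `u`, and both vanish. The hypotheses thus pass from `u` to `t u(t)`, bounded
support keeping the latter integrable. -/
theorem moment_eq_zero (n : ℕ) {u : ℝ → ℂ} (hu : Integrable u) {R : ℝ}
    (hs : ∀ t, R < |t| → u t = 0) (h : ∀ z : ℂ, 0 < z.im → cauchyPow 1 u z = 0) :
    ∫ t : ℝ, (t : ℂ) ^ n * u t = 0 := by
  induction n generalizing u with
  | zero => simpa using integral_eq_zero_of_cauchyPow_one hu h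
  | succ n ih =>
    have h1 := ih (integrable_ofReal_mul hu hs) (fun t ht => by simp [hs t ht]) fun z hz => ?_
    · rw [← h1]
      congr 1
      funext t
      ring
    · have h2 : ∀ t : ℝ, ((z - t) ^ 1)⁻¹ * (t * u t) = z * (((z - t) ^ 1)⁻¹ * u t) - u t := by
        intro t
        have := sub_ofReal_ne_zero hz t
        field_simp
        ring
      simp only [cauchyPow, h2]
      rw [integral_sub ((integrable_cauchyPow 1 hu hz).const_mul z) hu, integral_const_mul,
        ← cauchyPow, h z hz, integral_eq_zero_of_cauchyPow_one hu h]
      simp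

/-- Vanishing moments annihilate all polynomials. These approximate any test function uniformly on
`[-R, R]`, outside which `u` vanishes. -/
theorem ae_eq_zero_of_moments {u : ℝ → ℂ} (hu : Integrable u) {R : ℝ}
    (hs : ∀ t, R < |t| → u t = 0) (h : ∀ n : ℕ, ∫ t : ℝ, (t : ℂ) ^ n * u t = 0) :
    u =ᵐ[volume] 0 := by
  have hint : ∀ n : ℕ, Integrable fun t : ℝ => (t : ℂ) ^ n * u t := fun n => by
    induction n with
    | zero => simpa using hu
    | succ n ih =>
      refine (integrable_ofReal_mul ih (R := R) fun t ht => by simp [hs t ht]).congr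
        (Eventually.of_forall fun t => ?_)
      simp only
      ring
  have hterm : ∀ (p : Polynomial ℝ) (t : ℝ), ((p.eval t : ℝ) : ℂ) * u t =
      ∑ i ∈ Finset.range (p.natDegree + 1), (p.coeff i : ℂ) * ((t : ℂ) ^ i * u t) := by
    intro p t
    rw [Polynomial.eval_eq_sum_range]
    push_cast
    rw [Finset.sum_mul]
    simp only [mul_assoc]
  have hpi : ∀ p : Polynomial ℝ, Integrable fun t : ℝ => ((p.eval t : ℝ) : ℂ) * u t := by
    intro p
    simp only [hterm]
    exact integrable_finsetSum _ fun i _ => (hint i).const_mul _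
  have hp0 : ∀ p : Polynomial ℝ, ∫ t : ℝ, ((p.eval t : ℝ) : ℂ) * u t = 0 := by
    intro p
    simp only [hterm]
    rw [integral_finsetSum _ fun i _ => (hint i).const_mul _]
    simp only [integral_const_mul, h, mul_zero, Finset.sum_const_zero]
  refine ae_eq_zero_of_integral_contDiff_smul_eq_zero hu.locallyIntegrable fun g hg hgs => ?_
  rw [← norm_le_zero_iff]
  refine le_of_forall_pos_le_add fun ε hε => ?_
  have hI : 0 ≤ ∫ t, ‖u t‖ := integral_nonneg fun t => norm_nonneg _
  -- The `+ 1` keeps the tolerance meaningful when `u` has zero norm.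
  obtain ⟨p, hp⟩ := exists_polynomial_near_of_continuousOn (-R) R g hg.continuous.continuousOn
    (ε / ((∫ t, ‖u t‖) + 1)) (by positivity)
  have hgi : Integrable fun t => g t • u t :=
    hu.smul_of_top_right (hg.continuous.memLp_top_of_hasCompactSupport hgs volume)
  have h1 : ∫ t, g t • u t = ∫ t, (g t • u t - ((p.eval t : ℝ) : ℂ) * u t) := by
    rw [integral_sub hgi (hpi p), hp0, sub_zero]
  have h2 : ‖∫ t, g t • u t‖ ≤ ∫ t, ε / ((∫ t, ‖u t‖) + 1) * ‖u t‖ := by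
    rw [h1]
    refine norm_integral_le_of_norm_le (hu.norm.const_mul _) (Eventually.of_forall fun t => ?_)
    by_cases ht : R < |t|
    · simp [hs t ht]
    · have ht' := hp t (abs_le.1 (not_lt.1 ht))
      rw [Complex.real_smul, ← sub_mul, norm_mul, ← Complex.ofReal_sub, Complex.norm_real,
        Real.norm_eq_abs, abs_sub_comm]
      exact mul_le_mul_of_nonneg_right ht'.le (norm_nonneg _)
  rw [integral_const_mul] at h2
  refine h2.trans ?_
  rw [zero_add, div_mul_eq_mul_div, div_le_iff₀ (by positivity)]
  nlinarith

theorem ae_eq_zero_of_cauchyPow_two {u : ℝ → ℂ} (hu : Integrable u) {R : ℝ}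
    (hs : ∀ t, R < |t| → u t = 0) (h : ∀ z : ℂ, 0 < z.im → cauchyPow 2 u z = 0) :
    u =ᵐ[volume] 0 :=
  ae_eq_zero_of_moments hu hs fun n =>
    moment_eq_zero n hu hs fun _ hz => cauchyPow_one_eq_zero hu h hz

/-! ### Rigidity of the real part on a horizontal line: analyticity, reflection and Liouville. -/

theorem differentiableOn_cauchyPow (n : ℕ) {u : ℝ → ℂ} (hu : Integrable u) :
    DifferentiableOn ℂ (cauchyPow n u) {z | 0 < z.im} := fun _ hz =>
  (hasDerivAt_cauchyPow n hu hz).differentiableAt.differentiableWithinAt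

/-- The real part of a Cauchy type integral along a horizontal line is constant only if it is `0`. -/
theorem re_cauchyPow_eq_zero (n : ℕ) {u : ℝ → ℂ} (hu : Integrable u) {y : ℝ} (hy : 0 < y) (α : ℂ)
    {a b r : ℝ} (hab : a < b)
    (h : ∀ x ∈ Ioo a b, (α * cauchyPow (n + 1) u (x + y * Complex.I)).re = r) :
    r = 0 ∧ ∀ x : ℝ, (α * cauchyPow (n + 1) u (x + y * Complex.I)).re = 0 := by
  have hopen : IsOpen {z : ℂ | 0 < z.im} := isOpen_lt continuous_const Complex.continuous_im
  have han : AnalyticOnNhd ℝ (fun x : ℝ => (α * cauchyPow (n + 1) u (x + y * Complex.I)).re)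
      univ := by
    intro x _
    have h1 : AnalyticAt ℝ (fun x : ℝ => (x : ℂ) + y * Complex.I) x :=
      (Complex.ofRealCLM.analyticAt x).add analyticAt_const
    have h2 : AnalyticAt ℂ (cauchyPow (n + 1) u) (x + y * Complex.I) :=
      (differentiableOn_cauchyPow (n + 1) hu).analyticAt (hopen.mem_nhds (by simpa using hy))
    have h3 : AnalyticAt ℝ (fun x : ℝ => α * cauchyPow (n + 1) u (x + y * Complex.I)) x :=
      analyticAt_const.mul (AnalyticAt.comp (f := fun x : ℝ => (x : ℂ) + y * Complex.I)
        h2.restrictScalars h1)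
    exact (Complex.reCLM.analyticAt _).comp h3
  -- Real analyticity propagates the value `r` from a neighbourhood of the midpoint to the whole
  -- line.
  have heq : (fun x : ℝ => (α * cauchyPow (n + 1) u (x + y * Complex.I)).re) = fun _ => r := by
    refine han.eq_of_eventuallyEq (z₀ := (a + b) / 2) (fun _ _ => analyticAt_const) ?_
    filter_upwards [Ioo_mem_nhds (left_lt_add_div_two.2 hab) (add_div_two_lt_right.2 hab)] with x hx
    exact h x hx
  have hlim : Tendsto (fun x : ℝ => (α * cauchyPow (n + 1) u (x + y * Complex.I)).re) atTop
      (𝓝 0) := by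
    have := (Complex.continuous_re.tendsto _).comp
      ((tendsto_cauchyPow_zero n hu hy).const_mul α)
    rwa [mul_zero, Complex.zero_re] at this
  rw [heq] at hlim
  have hr : r = 0 := tendsto_nhds_unique tendsto_const_nhds hlim
  exact ⟨hr, fun x => (congrFun heq x).trans hr⟩

/-- A function holomorphic in a neighbourhood of the closed upper half-plane, bounded there, with
vanishing real part on the real line, is constant on the upper half-plane. -/
theorem exists_eq_const_of_re_eq_zero {H : ℂ → ℂ} {y M : ℝ} (hy : 0 < y)
    (hd : DifferentiableOn ℂ H {z | -y < z.im}) (hb : ∀ z : ℂ, 0 ≤ z.im → ‖H z‖ ≤ M)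
    (hre : ∀ x : ℝ, (H x).re = 0) : ∃ c, ∀ z : ℂ, 0 ≤ z.im → H z = c := by
  have hopen : IsOpen {z : ℂ | -y < z.im} := isOpen_lt continuous_const Complex.continuous_im
  have hopen' : IsOpen {z : ℂ | z.im < y} := isOpen_lt Complex.continuous_im continuous_const
  -- Schwarz reflection: `Re H = 0` on the real axis says `H = -conj H` there. Hence `H` and `H'`
  -- agree on the axis, and by the identity theorem on the strip where both are holomorphic.
  set H' : ℂ → ℂ := fun z => -(starRingEnd ℂ) (H ((starRingEnd ℂ) z)) with hH'
  have hd' : DifferentiableOn ℂ H' {z | z.im < y} := by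
    intro z hz
    have h1 : DifferentiableAt ℂ H ((starRingEnd ℂ) z) :=
      hd.differentiableAt (hopen.mem_nhds (by simpa using hz))
    have h2 := h1.conj_conj
    rw [Complex.conj_conj] at h2
    exact h2.neg.differentiableWithinAt
  have hstrip : IsPreconnected {z : ℂ | -y < z.im ∧ z.im < y} :=
    ((convex_halfSpace_im_gt (-y)).inter (convex_halfSpace_im_lt y)).isPreconnected
  have hagree : EqOn H H' {z : ℂ | -y < z.im ∧ z.im < y} := by
    have ho := hopen.inter hopen'
    refine ((hd.mono fun z hz => hz.1).analyticOnNhd ho).eqOn_of_preconnected_of_frequently_eq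
      ((hd'.mono fun z hz => hz.2).analyticOnNhd ho) hstrip (z₀ := 0) (by simp [hy]) ?_
    have hfr : ∃ᶠ x : ℝ in 𝓝[≠] (0 : ℝ), H x = H' x :=
      (Eventually.of_forall fun x : ℝ => by
        apply Complex.ext <;> simp [hH', hre]).frequently
    have ht : Tendsto (fun x : ℝ => (x : ℂ)) (𝓝[≠] (0 : ℝ)) (𝓝[≠] (0 : ℂ)) := by
      refine tendsto_nhdsWithin_iff.2 ⟨?_, ?_⟩
      · exact (Complex.continuous_ofReal.tendsto' 0 0 (by simp)).mono_left nhdsWithin_le_nhds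
      · filter_upwards [self_mem_nhdsWithin] with x hx
        simpa using hx
    exact ht.frequently hfr
  -- The glued function is entire, because the two domains overlap in the strip, and it inherits the
  -- bound `M` from the closed upper half-plane.
  set E : ℂ → ℂ := fun z => if 0 ≤ z.im then H z else H' z with hE
  have hE1 : EqOn E H {z | -y < z.im} := by
    intro z hz
    by_cases h0 : 0 ≤ z.im
    · simp [hE, h0]
    · simp only [hE, h0, if_false]
      exact (hagree ⟨hz, by linarith⟩).symm
  have hE2 : EqOn E H' {z | z.im < y} := by
    intro z hz
    by_cases h0 : 0 ≤ z.im
    · simp only [hE, h0, if_true]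
      exact hagree ⟨by linarith, hz⟩
    · simp [hE, h0]
  have hEd : Differentiable ℂ E := by
    intro z
    by_cases h0 : -y < z.im
    · exact (hd.differentiableAt (hopen.mem_nhds h0)).congr_of_eventuallyEq
        (hE1.eventuallyEq_of_mem (hopen.mem_nhds h0))
    · have h1 : z.im < y := by linarith
      exact (hd'.differentiableAt (hopen'.mem_nhds h1)).congr_of_eventuallyEq
        (hE2.eventuallyEq_of_mem (hopen'.mem_nhds h1))
  have hEb : Bornology.IsBounded (range E) := by
    rw [isBounded_iff_forall_norm_le]
    refine ⟨M, ?_⟩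
    rintro _ ⟨z, rfl⟩
    by_cases h0 : 0 ≤ z.im
    · simpa only [hE, h0, if_true] using hb z h0
    · simp only [hE, h0, if_false, hH', norm_neg, Complex.norm_conj]
      exact hb _ (by simp only [Complex.conj_im]; linarith)
  obtain ⟨c, hc⟩ := hEd.exists_const_forall_eq_of_bounded hEb
  exact ⟨c, fun z hz => by rw [← hc z]; simp [hE, hz]⟩

/-- Translating the line `Im z = y` to the real axis leaves room `y` below it for the reflection.
The resulting constant is zero by decay, and the identity theorem reaches the strip `0 < Im z < y`.
-/
theorem cauchyPow_eq_zero_of_re {n : ℕ} {u : ℝ → ℂ} (hu : Integrable u) {y : ℝ} (hy : 0 < y)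
    {α : ℂ} (hα : α ≠ 0) (h : ∀ x : ℝ, (α * cauchyPow (n + 1) u (x + y * Complex.I)).re = 0)
    {z : ℂ} (hz : 0 < z.im) : cauchyPow (n + 1) u z = 0 := by
  have hopen : IsOpen {z : ℂ | 0 < z.im} := isOpen_lt continuous_const Complex.continuous_im
  have hd : DifferentiableOn ℂ (fun z => α * cauchyPow (n + 1) u (z + y * Complex.I))
      {z | -y < z.im} := by
    intro w hw
    have h1 : 0 < (w + y * Complex.I).im := by
      simp only [mem_ofPred_eq] at hw
      simpa using by linarith
    have h2 := (hasDerivAt_cauchyPow (n + 1) hu h1).comp_add_const w _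
    exact (h2.const_mul α).differentiableAt.differentiableWithinAt
  have hb : ∀ w : ℂ, 0 ≤ w.im → ‖α * cauchyPow (n + 1) u (w + y * Complex.I)‖ ≤
      ‖α‖ * ((y ^ (n + 1))⁻¹ * ∫ t, ‖u t‖) := fun w hw => by
    rw [norm_mul]
    gcongr
    exact norm_cauchyPow_le (n + 1) hu hy (by simpa using hw)
  obtain ⟨c, hc⟩ := exists_eq_const_of_re_eq_zero
    (H := fun z => α * cauchyPow (n + 1) u (z + y * Complex.I))
    (M := ‖α‖ * ((y ^ (n + 1))⁻¹ * ∫ t, ‖u t‖)) hy hd hb h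
  have hc0 : c = 0 := by
    refine tendsto_nhds_unique ?_
      (by simpa using (tendsto_cauchyPow_zero n hu hy).const_mul α)
    exact tendsto_const_nhds.congr fun x : ℝ => (hc x (by simp)).symm
  have hzero : ∀ w : ℂ, y ≤ w.im → cauchyPow (n + 1) u w = 0 := fun w hw => by
    have h1 := hc (w - y * Complex.I) (by simpa using hw)
    simpa [hc0, hα] using h1
  have hpre : IsPreconnected {z : ℂ | 0 < z.im} := (convex_halfSpace_im_gt 0).isPreconnected
  refine ((differentiableOn_cauchyPow (n + 1) hu).analyticOnNhd
    hopen).eqOn_zero_of_preconnected_of_eventuallyEq_zero hpre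
    (z₀ := (y + 1 : ℝ) * Complex.I) (by simp; linarith) ?_ hz
  have hmem : {w : ℂ | y < w.im} ∈ 𝓝 ((y + 1 : ℝ) * Complex.I) :=
    (isOpen_lt continuous_const Complex.continuous_im).mem_nhds (by simp)
  filter_upwards [hmem] with w hw
  exact hzero w (le_of_lt hw)

end Magnet2D

/-! ### Fourier side: `I + iℋ` turns `∂_x P_h` into a Cauchy kernel. -/

namespace Magnet2D

open scoped FourierTransform SchwartzMap

/-- On `L¹ ∩ L²` the inverse Fourier transform of `L²` is given by the Fourier integral. -/
theorem fourierInv_toLp {f : ℝ → ℂ} (hf : Integrable f) (hf2 : MemLp f 2) (hg : MemLp (𝓕⁻ f) 2) :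
    (Lp.fourierTransformₗᵢ ℝ ℂ).symm (hf2.toLp f) = hg.toLp (𝓕⁻ f) := by
  change 𝓕⁻ (hf2.toLp f) = _
  -- `L²` embeds in the tempered distributions, where the claim can be tested against Schwartz
  -- functions.
  have hinj := LinearMap.ker_eq_bot.1
    (Lp.ker_toTemperedDistributionCLM_eq_bot (E := ℝ) (F := ℂ) (μ := volume) (p := 2))
  apply hinj
  change ((𝓕⁻ (hf2.toLp f) : L2R ℂ) : 𝓢'(ℝ, ℂ)) = ((hg.toLp (𝓕⁻ f) : L2R ℂ) : 𝓢'(ℝ, ℂ))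
  rw [← Lp.fourierInv_toTemperedDistribution_eq]
  ext φ
  rw [TemperedDistribution.fourierInv_apply, Lp.toTemperedDistribution_apply,
    Lp.toTemperedDistribution_apply]
  have h1 : ∫ x, (𝓕⁻ φ : 𝓢(ℝ, ℂ)) x • (hf2.toLp f) x = ∫ x, (𝓕⁻ (φ : ℝ → ℂ)) x • f x := by
    refine integral_congr_ae ?_
    filter_upwards [hf2.coeFn_toLp] with x hx
    rw [hx, SchwartzMap.fourierInv_coe]
  have h2 : ∫ x, φ x • (hg.toLp (𝓕⁻ f)) x = ∫ x, φ x • (𝓕⁻ f) x := by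
    refine integral_congr_ae ?_
    filter_upwards [hg.coeFn_toLp] with x hx
    rw [hx]
  rw [h1, h2]
  -- Fubini moves the transform from the test function to `f`. The form `-innerₗ ℝ` selects the
  -- inverse transform and is symmetric.
  have h3 := VectorFourier.integral_fourierIntegral_smul_eq_flip (L := -innerₗ ℝ) (μ := volume)
    (ν := volume) Real.continuous_fourierChar (by fun_prop) φ.integrable hf
  have hL : (-innerₗ ℝ).flip = -innerₗ ℝ := by
    ext
    simp
  rw [hL] at h3
  exact h3

theorem integrableOn_mul_exp_neg {b : ℝ} (hb : 0 < b) :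
    IntegrableOn (fun ξ : ℝ => ξ * Real.exp (-b * ξ)) (Ioi 0) := by
  simpa using integrableOn_rpow_mul_exp_neg_mul_rpow (s := 1) (p := 1) (b := b) (by norm_num)
    one_pos hb

theorem integrableOn_sq_mul_exp_neg {b : ℝ} (hb : 0 < b) :
    IntegrableOn (fun ξ : ℝ => ξ ^ 2 * Real.exp (-b * ξ)) (Ioi 0) := by
  simpa using integrableOn_rpow_mul_exp_neg_mul_rpow (s := 2) (p := 1) (b := b) (by norm_num)
    one_pos hb

theorem norm_mul_cexp_neg {s : ℂ} {ξ : ℝ} (hξ : 0 ≤ ξ) :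
    ‖(ξ : ℂ) * Complex.exp (-s * ξ)‖ = ξ * Real.exp (-s.re * ξ) := by
  rw [norm_mul, Complex.norm_real, Complex.norm_exp, Real.norm_of_nonneg hξ]
  simp

theorem integrableOn_mul_cexp_neg {s : ℂ} (hs : 0 < s.re) :
    IntegrableOn (fun ξ : ℝ => (ξ : ℂ) * Complex.exp (-s * ξ)) (Ioi 0) := by
  refine (integrableOn_mul_exp_neg hs).mono' (by fun_prop) ?_
  filter_upwards [ae_restrict_mem measurableSet_Ioi] with ξ hξ
  exact (norm_mul_cexp_neg (le_of_lt hξ)).le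

theorem integral_mul_cexp_neg {s : ℂ} (hs : 0 < s.re) :
    ∫ ξ : ℝ in Ioi 0, (ξ : ℂ) * Complex.exp (-s * ξ) = (s ^ 2)⁻¹ := by
  have hs0 : s ≠ 0 := fun h => by simp [h] at hs
  have hexp : Tendsto (fun ξ : ℝ => Complex.exp (-s * ξ)) atTop (𝓝 0) := by
    rw [tendsto_zero_iff_norm_tendsto_zero]
    have h1 : ∀ ξ : ℝ, ‖Complex.exp (-s * ξ)‖ = Real.exp (-(s.re * ξ)) := fun ξ => by
      rw [Complex.norm_exp]; simp
    simp only [h1]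
    exact Real.tendsto_exp_neg_atTop_nhds_zero.comp (tendsto_id.const_mul_atTop hs)
  have hmul : Tendsto (fun ξ : ℝ => (ξ : ℂ) * Complex.exp (-s * ξ)) atTop (𝓝 0) := by
    rw [tendsto_zero_iff_norm_tendsto_zero]
    have h2 : Tendsto (fun ξ : ℝ => s.re⁻¹ * ((s.re * ξ) ^ 1 * Real.exp (-(s.re * ξ)))) atTop
        (𝓝 (s.re⁻¹ * 0)) :=
      ((Real.tendsto_pow_mul_exp_neg_atTop_nhds_zero 1).comp
        (tendsto_id.const_mul_atTop hs)).const_mul _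
    rw [mul_zero] at h2
    refine h2.congr' ?_
    filter_upwards [eventually_ge_atTop 0] with ξ hξ
    rw [norm_mul_cexp_neg hξ]
    field_simp
  -- This is the antiderivative given by one integration by parts. It vanishes at infinity and
  -- equals `-s⁻²` at `0`.
  have hlim : Tendsto (fun ξ : ℝ => -s⁻¹ * ((ξ : ℂ) * Complex.exp (-s * ξ)) -
      (s ^ 2)⁻¹ * Complex.exp (-s * ξ)) atTop (𝓝 0) := by
    simpa using (hmul.const_mul (-s⁻¹)).sub (hexp.const_mul (s ^ 2)⁻¹)
  rw [integral_Ioi_of_hasDerivAt_of_tendsto' (fun ξ _ => ?_) (integrableOn_mul_cexp_neg hs) hlim]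
  · simp
  · have h1 : HasDerivAt (fun ξ : ℝ => (ξ : ℂ)) 1 ξ := Complex.ofRealCLM.hasDerivAt
    have h2 := (h1.const_mul (-s)).cexp
    refine (((h1.mul h2).const_mul (-s⁻¹)).sub (h2.const_mul (s ^ 2)⁻¹)).congr_deriv ?_
    field_simp
    ring

/-- The one-sided density `ξ ↦ -4πi ξ e^{-2πi ξ w}` on `ξ > 0`. -/
noncomputable def posDensity (w : ℂ) : ℝ → ℂ :=
  (Ioi 0).indicator fun ξ : ℝ =>
    -4 * Real.pi * Complex.I * ((ξ : ℂ) * Complex.exp (-(2 * Real.pi * Complex.I * w) * ξ))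

theorem re_exponent (w : ℂ) : (2 * Real.pi * Complex.I * w).re = -(2 * Real.pi * w.im) := by
  simp

theorem re_exponent_pos {w : ℂ} (hw : w.im < 0) : 0 < (2 * Real.pi * Complex.I * w).re := by
  rw [re_exponent]
  have := mul_pos Real.two_pi_pos (neg_pos.2 hw)
  linarith

theorem integrable_posDensity {w : ℂ} (hw : w.im < 0) : Integrable (posDensity w) :=
  (integrable_indicator_iff measurableSet_Ioi).2
    ((integrableOn_mul_cexp_neg (re_exponent_pos hw)).const_mul _)

theorem memLp_posDensity {w : ℂ} (hw : w.im < 0) : MemLp (posDensity w) 2 := by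
  have hs := re_exponent_pos hw
  rw [posDensity, memLp_indicator_iff_restrict measurableSet_Ioi]
  refine MemLp.const_mul ?_ _
  rw [memLp_two_iff_integrable_sq_norm (by fun_prop)]
  refine (integrableOn_sq_mul_exp_neg (mul_pos two_pos hs)).congr ?_
  filter_upwards [ae_restrict_mem measurableSet_Ioi] with ξ hξ
  rw [norm_mul_cexp_neg (le_of_lt hξ), mul_pow, ← Real.exp_nat_mul]
  congr 2
  push_cast
  ring

/-- The Fourier phase replaces `w` by `w - t`, leaving a Laplace integral with `s = 2πi(w - t)`. The
factor `-4πi` in the density turns `s⁻²` into `(i/π)(t - w)⁻²`. -/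
theorem fourierInv_posDensity {w : ℂ} (hw : w.im < 0) (t : ℝ) :
    𝓕⁻ (posDensity w) t = Complex.I / Real.pi * ((t - w) ^ 2)⁻¹ := by
  have hw' : (w - t).im < 0 := by simpa using hw
  have hne : (w - t : ℂ) ≠ 0 := fun h => by simp [h] at hw'
  have hπ : (Real.pi : ℂ) ≠ 0 := by exact_mod_cast Real.pi_ne_zero
  have h1 : ∀ ξ : ℝ, Complex.exp ((2 * Real.pi * inner ℝ ξ t : ℝ) * Complex.I) • posDensity w ξ =
      posDensity (w - t) ξ := by
    intro ξ
    by_cases hξ : ξ ∈ Ioi (0 : ℝ)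
    · simp only [posDensity, indicator_of_mem hξ, smul_eq_mul]
      rw [mul_left_comm, mul_left_comm _ (ξ : ℂ), ← Complex.exp_add]
      congr 4
      simp
      ring
    · simp [posDensity, indicator_of_notMem hξ]
  rw [Real.fourierInv_eq']
  simp only [h1]
  rw [posDensity, integral_indicator measurableSet_Ioi, integral_const_mul,
    integral_mul_cexp_neg (re_exponent_pos hw')]
  have hne' : (t - w : ℂ) ≠ 0 := fun h => hne (by rw [← neg_sub, h, neg_zero])
  have hI : Complex.I ≠ 0 := Complex.I_ne_zero
  have h2 : (2 * Real.pi * Complex.I * (w - t)) ^ 2 = -(4 * Real.pi ^ 2 * (t - w) ^ 2) := by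
    linear_combination (4 * (Real.pi : ℂ) ^ 2 * (w - t) ^ 2) * Complex.I_sq
  rw [h2]
  field_simp

/-- This lets the real part of an inverse transform be taken on the frequency side. -/
theorem fourierInv_conj_neg (f : ℝ → ℂ) (t : ℝ) :
    𝓕⁻ (fun ξ => (starRingEnd ℂ) (f (-ξ))) t = (starRingEnd ℂ) (𝓕⁻ f t) := by
  rw [Real.fourierInv_eq', Real.fourierInv_eq', ← integral_conj, ← integral_neg_eq_self]
  congr 1
  funext ξ
  simp [← Complex.exp_conj, Complex.conj_ofNat]

theorem kernel_eq {h : ℝ} (hh : 0 < h) (x : ℝ) :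
    Complex.I / Real.pi * ((x - h * Complex.I) ^ 2)⁻¹ = dxP h x + Complex.I * dyP h x := by
  have hne : (x : ℂ) - h * Complex.I ≠ 0 := fun h0 => by
    have := congrArg Complex.im h0
    simp at this
    exact hh.ne' this
  have hD : (x : ℂ) ^ 2 + h ^ 2 ≠ 0 := by
    have : x ^ 2 + h ^ 2 ≠ 0 := by positivity
    exact_mod_cast this
  have hπ : (Real.pi : ℂ) ≠ 0 := by exact_mod_cast Real.pi_ne_zero
  have h1 : ((x : ℂ) - h * Complex.I) * (x + h * Complex.I) = x ^ 2 + h ^ 2 := by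
    linear_combination (-(h : ℂ) ^ 2) * Complex.I_sq
  have hne2 : (x : ℂ) + h * Complex.I ≠ 0 := fun h0 => hD (by rw [← h1, h0, mul_zero])
  have h2 : Complex.I * ((x : ℂ) + h * Complex.I) ^ 2 =
      -(2 * x * h) + Complex.I * (x ^ 2 - h ^ 2) := by
    linear_combination (2 * (h : ℂ) * x + (h : ℂ) ^ 2 * Complex.I) * Complex.I_sq
  have h3 : (dxP h x : ℂ) + Complex.I * dyP h x =
      1 / Real.pi * ((-(2 * x * h) + Complex.I * (x ^ 2 - h ^ 2)) / (x ^ 2 + h ^ 2) ^ 2) := by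
    simp only [dxP, dyP]
    push_cast
    ring
  rw [h3, ← h2, ← h1]
  generalize (x : ℂ) - h * Complex.I = p at *
  generalize (x : ℂ) + h * Complex.I = q at *
  field_simp

/-- The complex kernel `∂_x P_h - i ∂_y P_h`, written through `cauchyPow`. -/
theorem kernel_conj_eq {h : ℝ} (hh : 0 < h) (x : ℝ) :
    -(Complex.I / Real.pi) * ((x + h * Complex.I) ^ 2)⁻¹ = dxP h x - Complex.I * dyP h x := by
  have := congrArg (starRingEnd ℂ) (kernel_eq hh x)
  simpa [← sub_eq_add_neg, neg_div] using this

theorem memLp_shift_ofReal {k : ℝ → ℝ} (hk : MemLp k 2) (x : ℝ) :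
    MemLp (fun t : ℝ => (k (x - t) : ℂ)) 2 :=
  (memLp_shift hk x).ofReal

theorem memLp_kernel {h : ℝ} (hh : 0 < h) (x : ℝ) :
    MemLp (fun t : ℝ => (dxP h (x - t) : ℂ) + Complex.I * dyP h (x - t)) 2 := by
  have h1 := memLp_shift_ofReal (memLp_dxP hh) x
  have h2 := (memLp_shift_ofReal (memLp_dyP hh) x).const_mul Complex.I
  exact h1.add h2

theorem fourierInv_posDensity_kernel {h : ℝ} (hh : 0 < h) (x : ℝ) :
    𝓕⁻ (posDensity (x - h * Complex.I)) =
      fun t : ℝ => (dxP h (x - t) : ℂ) + Complex.I * dyP h (x - t) := by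
  funext t
  rw [fourierInv_posDensity (by simpa using hh), ← kernel_eq hh]
  congr 2
  push_cast
  ring

/-- The even part of the Fourier density, whose inverse transform is `t ↦ ∂_x P_h (x - t)`. -/
theorem fourierInv_evenDensity {h : ℝ} (hh : 0 < h) (x : ℝ) :
    𝓕⁻ (fun ξ => (1 / 2 : ℂ) * (posDensity (x - h * Complex.I) ξ +
      (starRingEnd ℂ) (posDensity (x - h * Complex.I) (-ξ)))) =
      fun t : ℝ => (dxP h (x - t) : ℂ) := by
  have hw : (x - h * Complex.I : ℂ).im < 0 := by simpa using hh
  have hi := integrable_posDensity hw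
  have hi' : Integrable fun ξ => (starRingEnd ℂ) (posDensity (x - h * Complex.I) (-ξ)) :=
    (Complex.conjCLE.toContinuousLinearMap.integrable_comp hi.comp_neg)
  funext t
  have h1 := fourierInv_conj_neg (posDensity (x - h * Complex.I)) t
  rw [fourierInv_posDensity_kernel hh] at h1
  have h2 := congrFun (fourierInv_posDensity_kernel hh x) t
  rw [Real.fourierInv_eq'] at h1 h2 ⊢
  have he : ∀ (g : ℝ → ℂ), Integrable g → Integrable fun ξ : ℝ =>
      Complex.exp ((2 * Real.pi * inner ℝ ξ t : ℝ) * Complex.I) • g ξ := fun g hg => by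
    refine hg.bdd_mul (c := 1) (Continuous.aestronglyMeasurable (by fun_prop))
      (Eventually.of_forall fun ξ => ?_)
    rw [Complex.norm_exp_ofReal_mul_I]
  have h3 : ∀ (e p q : ℂ), e • (1 / 2 * (p + q)) = 1 / 2 * (e • p + e • q) := fun e p q => by
    simp only [smul_eq_mul]; ring
  simp only [h3]
  rw [integral_const_mul, integral_add (he _ hi) (he _ hi'), h1, h2]
  simp
  ring

/-- The symbol is `1 + i(-i sgn ξ) = 1 + sgn ξ`, that is, `2` on positive and `0` on negative
frequencies. -/
theorem hilbert_fourier (u : L2R ℂ) :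
    (Lp.fourierTransformₗᵢ ℝ ℂ) (u + Complex.I • hilbert u) =ᵐ[volume]
      fun ξ => (1 + (Real.sign ξ : ℂ)) * (Lp.fourierTransformₗᵢ ℝ ℂ) u ξ := by
  have h1 : (Lp.fourierTransformₗᵢ ℝ ℂ) (hilbert u) =
      (ContinuousLinearMap.mul ℂ ℂ).holder 2 hilbertSymbol ((Lp.fourierTransformₗᵢ ℝ ℂ) u) :=
    (Lp.fourierTransformₗᵢ ℝ ℂ).apply_symm_apply _
  rw [map_add, map_smul, h1]
  filter_upwards [Lp.coeFn_add ((Lp.fourierTransformₗᵢ ℝ ℂ) u)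
      (Complex.I • (ContinuousLinearMap.mul ℂ ℂ).holder 2 hilbertSymbol
        ((Lp.fourierTransformₗᵢ ℝ ℂ) u)),
    Lp.coeFn_smul Complex.I ((ContinuousLinearMap.mul ℂ ℂ).holder 2 hilbertSymbol
        ((Lp.fourierTransformₗᵢ ℝ ℂ) u)),
    (ContinuousLinearMap.mul ℂ ℂ).coeFn_holder (r := 2) hilbertSymbol
        ((Lp.fourierTransformₗᵢ ℝ ℂ) u),
    MemLp.coeFn_toLp (p := ∞) (f := fun ξ : ℝ => -Complex.I * (Real.sign ξ : ℂ))
      ((Lp.memLp hilbertSymbol).ae_eq (MemLp.coeFn_toLp _))] with ξ h2 h3 h4 h5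
  have h5' : hilbertSymbol ξ = -Complex.I * (Real.sign ξ : ℂ) := h5
  rw [h2, Pi.add_apply, h3, Pi.smul_apply, h4, h5', smul_eq_mul, ContinuousLinearMap.mul_apply']
  linear_combination (-(Real.sign ξ : ℂ) * (Lp.fourierTransformₗᵢ ℝ ℂ) u ξ) * Complex.I_sq

theorem conv_eq_inner {k : ℝ → ℝ} (hk : MemLp k 2) (v : L2R ℂ) (x : ℝ) :
    conv k v x = inner ℂ ((memLp_shift_ofReal hk x).toLp _) v := by
  rw [conv_apply, L2.inner_def]
  refine integral_congr_ae ?_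
  filter_upwards [(memLp_shift_ofReal hk x).coeFn_toLp] with t ht
  rw [ht]
  simp [mul_comm]

/-- `∂_x P_h ⋆ (I + iℋ) u` is the convolution of `u` with `∂_x P_h - i ∂_y P_h`. -/
theorem conv_dxP_analytic {h : ℝ} (hh : 0 < h) (u : L2R ℂ) (x : ℝ) :
    conv (dxP h) (u + Complex.I • hilbert u) x =
      -(Complex.I / Real.pi) * cauchyPow 2 u (x + h * Complex.I) := by
  have hw : (x - h * Complex.I : ℂ).im < 0 := by simpa using hh
  set ψ := posDensity (x - h * Complex.I) with hψ
  have hi : Integrable ψ := integrable_posDensity hw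
  have hm : MemLp ψ 2 := memLp_posDensity hw
  have hi' : Integrable fun ξ => (starRingEnd ℂ) (ψ (-ξ)) :=
    (Complex.conjCLE.toContinuousLinearMap.integrable_comp hi.comp_neg)
  have hm' : MemLp (fun ξ => (starRingEnd ℂ) (ψ (-ξ))) 2 :=
    Complex.conjCLE.toContinuousLinearMap.comp_memLp'
      (hm.comp_measurePreserving (Measure.measurePreserving_neg volume))
  have hme : MemLp (fun ξ => (1 / 2 : ℂ) * (ψ ξ + (starRingEnd ℂ) (ψ (-ξ)))) 2 :=
    (hm.add hm').const_mul _
  have hg : MemLp (𝓕⁻ ψ) 2 := by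
    rw [fourierInv_posDensity_kernel hh]; exact memLp_kernel hh x
  have hge : MemLp (𝓕⁻ fun ξ => (1 / 2 : ℂ) * (ψ ξ + (starRingEnd ℂ) (ψ (-ξ)))) 2 := by
    rw [fourierInv_evenDensity hh]; exact memLp_shift_ofReal (memLp_dxP hh) x
  have e1 := fourierInv_toLp hi hm hg
  have e2 := fourierInv_toLp
    (f := fun ξ => (1 / 2 : ℂ) * (ψ ξ + (starRingEnd ℂ) (ψ (-ξ)))) ((hi.add hi').const_mul (1 / 2 : ℂ)) hme hge
  have e3 : (memLp_shift_ofReal (memLp_dxP hh) x).toLp _ =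
      (Lp.fourierTransformₗᵢ ℝ ℂ).symm (hme.toLp _) := by
    rw [e2]
    exact MemLp.toLp_congr _ _ (by rw [fourierInv_evenDensity hh])
  have hadj : ∀ (f : L2R ℂ) (v : L2R ℂ), inner ℂ ((Lp.fourierTransformₗᵢ ℝ ℂ).symm f) v =
      inner ℂ f ((Lp.fourierTransformₗᵢ ℝ ℂ) v) := fun f v => by
    rw [← (Lp.fourierTransformₗᵢ ℝ ℂ).inner_map_map, LinearIsometryEquiv.apply_symm_apply]
  -- For `ξ > 0` the symbol `2` cancels the `1/2` of the even density, whose reflected half vanishes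
  -- there. For `ξ < 0` both sides are zero, and `ξ = 0` is a null set.
  have h1 : inner ℂ (hme.toLp _) ((Lp.fourierTransformₗᵢ ℝ ℂ) (u + Complex.I • hilbert u)) =
      inner ℂ (hm.toLp _) ((Lp.fourierTransformₗᵢ ℝ ℂ) u) := by
    rw [L2.inner_def, L2.inner_def]
    refine integral_congr_ae ?_
    filter_upwards [hme.coeFn_toLp, hm.coeFn_toLp, hilbert_fourier u,
      compl_mem_ae_iff.2 (measure_singleton (μ := (volume : Measure ℝ)) 0)] with ξ k1 k2 k3 hξ
    rw [k1, k2, k3]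
    rcases lt_or_gt_of_ne (show ξ ≠ 0 from hξ) with h0 | h0
    · have : ψ ξ = 0 := indicator_of_notMem (by simpa using h0.le) _
      simp [this, Real.sign_of_neg h0]
    · have : ψ (-ξ) = 0 := indicator_of_notMem (by simpa using h0.le) _
      simp only [this, Real.sign_of_pos h0, map_zero, add_zero, RCLike.inner_apply, map_mul,
        map_div₀, map_one, Complex.conj_ofNat, Complex.ofReal_one]
      ring
  rw [conv_eq_inner (memLp_dxP hh), e3, hadj, h1, ← hadj, e1, L2.inner_def, cauchyPow,
    ← integral_const_mul]
  refine integral_congr_ae ?_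
  filter_upwards [hg.coeFn_toLp] with t ht
  rw [ht, hψ, fourierInv_posDensity_kernel hh, ← mul_assoc]
  have h3 : (x + h * Complex.I - t : ℂ) = ((x - t : ℝ) : ℂ) + h * Complex.I := by push_cast; ring
  rw [h3, kernel_conj_eq hh]
  simp
  ring

end Magnet2D

/-! ### Pointwise formulas for the four operators. -/

namespace Magnet2D

theorem coeFn_toL2 {𝕜 X F : Type*} [NontriviallyNormedField 𝕜] [NormedAddCommGroup X]
    [NormedSpace 𝕜 X] [NormedAddCommGroup F] [NormedSpace 𝕜 F] (a b : ℝ) (T : X →ₗ[𝕜] (ℝ → F))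
    (hT : ∀ u, AEStronglyMeasurable (T u) (volume.restrict (Ioo a b))) (C : ℝ)
    (hC : ∀ u x, ‖T u x‖ ≤ C * ‖u‖) (u : X) :
    toL2 a b T hT C hC u =ᵐ[volume.restrict (Ioo a b)] T u :=
  MemLp.coeFn_toLp (MemLp.of_bound (hT u) (C * ‖u‖) (Eventually.of_forall (hC u)))

theorem memLp_indicator {E : Type*} [NormedAddCommGroup E] {a b : ℝ} (u : L2 (Ioo a b) E) :
    MemLp ((Ioo a b).indicator u) 2 volume :=
  (memLp_indicator_iff_restrict measurableSet_Ioo).2 (Lp.memLp u)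

theorem coeFn_ext (𝕜 : Type*) {E : Type*} [NontriviallyNormedField 𝕜] [NormedAddCommGroup E]
    [NormedSpace 𝕜 E] (a b : ℝ) (u : L2 (Ioo a b) E) :
    ext 𝕜 a b u =ᵐ[volume] (Ioo a b).indicator u := by
  rw [ext, LinearMap.mkContinuous_apply]
  exact MemLp.coeFn_toLp (memLp_indicator u)

theorem cauchyPow_congr (n : ℕ) {u v : ℝ → ℂ} (h : u =ᵐ[volume] v) :
    cauchyPow n u = cauchyPow n v := by
  funext z
  exact integral_congr_ae (h.mono fun t ht => by simp only [ht])

theorem integrable_indicator_L2 {E : Type*} [NormedAddCommGroup E] {a b : ℝ}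
    (u : L2 (Ioo a b) E) : Integrable ((Ioo a b).indicator u) :=
  (integrable_indicator_iff measurableSet_Ioo).2
    (memLp_one_iff_integrable.1 ((Lp.memLp u).mono_exponent (by norm_num)))

/-- The complex field `∂_x (P_h ⋆ (I + iℋ) u)` generated by `u`. -/
noncomputable def analyticField (h : ℝ) (u : ℝ → ℂ) (x : ℝ) : ℂ :=
  -(Complex.I / Real.pi) * cauchyPow 2 u (x + h * Complex.I)

/-- Expansion of `(∂_x P_h - i ∂_y P_h) ⋆ (f + ig)`. Its real part is minus the field that `b₂`
assigns to `(f, g)`. -/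
theorem analyticField_eq {h : ℝ} (hh : 0 < h) {f g : ℝ → ℝ} (hf : MemLp f 2) (hg : MemLp g 2)
    (x : ℝ) : analyticField h (fun t => f t + Complex.I * g t) x =
      (conv (dxP h) f x + conv (dyP h) g x : ℝ) +
        Complex.I * (conv (dxP h) g x - conv (dyP h) f x : ℝ) := by
  have i1 := integrable_shift_smul (memLp_dxP hh) hf x
  have i2 := integrable_shift_smul (memLp_dyP hh) hg x
  have i3 := integrable_shift_smul (memLp_dxP hh) hg x
  have i4 := integrable_shift_smul (memLp_dyP hh) hf x
  simp only [conv_apply]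
  rw [← integral_add i1 i2, ← integral_sub i3 i4, ← integral_complex_ofReal,
    ← integral_complex_ofReal, ← integral_const_mul, ← integral_add (i1.add i2).ofReal
      ((i3.sub i4).ofReal.const_mul _), analyticField, cauchyPow, ← integral_const_mul]
  congr 1
  funext t
  have h3 : (x + h * Complex.I - t : ℂ) = ((x - t : ℝ) : ℂ) + h * Complex.I := by push_cast; ring
  rw [← mul_assoc, h3, kernel_conj_eq hh]
  simp only [smul_eq_mul]
  push_cast
  linear_combination (-(dyP h (x - t) : ℂ) * g t) * Complex.I_sq

theorem coeFn_dPoisson_analytic {h : ℝ} (hh : 0 < h) (a b c d : ℝ) (u : L2 (Ioo a b) ℂ) :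
    (dPoisson hh c d ∘L (ContinuousLinearMap.id ℂ (L2R ℂ) + Complex.I • hilbert) ∘L
      ext ℂ a b) u =ᵐ[volume.restrict (Ioo c d)] analyticField h ((Ioo a b).indicator u) := by
  refine (coeFn_toL2 c d (dPoissonFun hh) (dPoissonFun_measurable hh c d) _ (dPoissonFun_bound hh)
    _).trans (Eventually.of_forall fun x => ?_)
  refine (hasDerivAt_conv_P_snd hh (Lp.memLp _) x).deriv.trans ?_
  rw [analyticField, ← cauchyPow_congr 2 (coeFn_ext ℂ a b u), ← conv_dxP_analytic hh]
  rfl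

theorem coeFn_B₂ {h : ℝ} (hh : 0 < h) (a b c d : ℝ) (m : L2 (Ioo a b) ℂ) :
    B₂ hh a b c d m =ᵐ[volume.restrict (Ioo c d)]
      fun x => -(analyticField h ((Ioo a b).indicator m) x).re := by
  set v := (dPoisson hh c d ∘L (ContinuousLinearMap.id ℂ (L2R ℂ) + Complex.I • hilbert) ∘L
      ext ℂ a b) m with hv
  have h0 : B₂ hh a b c d m = -(Complex.reCLM.compLpL 2 (volume.restrict (Ioo c d)) v) := rfl
  rw [h0]
  filter_upwards [Lp.coeFn_neg (Complex.reCLM.compLpL 2 (volume.restrict (Ioo c d)) v),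
    Complex.reCLM.coeFn_compLpL (p := 2) (μ := volume.restrict (Ioo c d)) v,
    coeFn_dPoisson_analytic hh a b c d m] with x h1 h2 h3
  rw [h1, Pi.neg_apply, h2, hv, h3]
  rfl

theorem indicator_ofReal (a b : ℝ) (φ : ℝ → ℝ) (t : ℝ) :
    (Ioo a b).indicator (fun t => (φ t : ℂ)) t = (((Ioo a b).indicator φ t : ℝ) : ℂ) := by
  by_cases ht : t ∈ Ioo a b <;> simp [ht]

theorem coeFn_B₂star {h : ℝ} (hh : 0 < h) (a b c d : ℝ) (φ : L2 (Ioo c d) ℝ) :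
    B₂star hh a b c d φ =ᵐ[volume.restrict (Ioo a b)]
      analyticField h (fun t => (((Ioo c d).indicator φ t : ℝ) : ℂ)) := by
  refine (coeFn_dPoisson_analytic hh c d a b
    (Complex.ofRealCLM.compLpL 2 (volume.restrict (Ioo c d)) φ)).trans
      (Eventually.of_forall fun x => ?_)
  have h1 := (ae_eq_restrict_iff_indicator_ae_eq (measurableSet_Ioo (a := c) (b := d))).1
    (Complex.ofRealCLM.coeFn_compLpL (p := 2) (μ := volume.restrict (Ioo c d)) φ)
  rw [analyticField, analyticField, cauchyPow_congr 2 h1]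
  congr 3
  funext t
  exact indicator_ofReal c d φ t

theorem coeFn_b₂ {h : ℝ} (hh : 0 < h) (a b c d : ℝ)
    (m : L2 (Ioo a b) (EuclideanSpace ℝ (Fin 2))) :
    b₂ hh a b c d m =ᵐ[volume.restrict (Ioo c d)] fun x =>
      -(conv (dxP h) ((Ioo a b).indicator fun t => m t 0) x +
        conv (dyP h) ((Ioo a b).indicator fun t => m t 1) x) := by
  have hcoord : ∀ i : Fin 2, (fun t => ext ℝ a b m t i) =ᵐ[volume]
      (Ioo a b).indicator fun t => m t i := fun i => by
    filter_upwards [coeFn_ext ℝ a b m] with t ht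
    rw [ht]
    by_cases h0 : t ∈ Ioo a b <;> simp [h0]
  refine (coeFn_toL2 c d (fieldFun hh) (fieldFun_measurable hh c d) _ (fieldFun_bound hh)
    _).trans (Eventually.of_forall fun x => ?_)
  refine (congrArg Neg.neg (deriv_field hh (ext ℝ a b m) x)).trans ?_
  rw [conv_congr _ (hcoord 0), conv_congr _ (hcoord 1)]

/-! ### Passage between `ℝ²`-valued and complex sources, and the adjoint of `b₂`. -/

/-- The identification `(m₁, m₂) ↦ m₁ + i m₂` of `L²(I, ℝ²)` with `L²(I, ℂ)`. -/
noncomputable def toComplex (a b : ℝ) :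
    L2 (Ioo a b) (EuclideanSpace ℝ (Fin 2)) →L[ℝ] L2 (Ioo a b) ℂ :=
  (Complex.orthonormalBasisOneI.repr.symm.toContinuousLinearEquiv :
    EuclideanSpace ℝ (Fin 2) →L[ℝ] ℂ).compLpL 2 (volume.restrict (Ioo a b))

/-- The identification `m ↦ (Re m, Im m)` of `L²(I, ℂ)` with `L²(I, ℝ²)`. -/
noncomputable def ofComplex (a b : ℝ) :
    L2 (Ioo a b) ℂ →L[ℝ] L2 (Ioo a b) (EuclideanSpace ℝ (Fin 2)) :=
  (Complex.orthonormalBasisOneI.repr.toContinuousLinearEquiv :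
    ℂ →L[ℝ] EuclideanSpace ℝ (Fin 2)).compLpL 2 (volume.restrict (Ioo a b))

theorem coeFn_toComplex (a b : ℝ) (m : L2 (Ioo a b) (EuclideanSpace ℝ (Fin 2))) :
    toComplex a b m =ᵐ[volume.restrict (Ioo a b)] fun t => (m t 0 : ℂ) + Complex.I * m t 1 := by
  refine (ContinuousLinearMap.coeFn_compLpL (p := 2) (μ := volume.restrict (Ioo a b)) _ m).trans
    (Eventually.of_forall fun t => ?_)
  simp [mul_comm]

theorem coeFn_ofComplex (a b : ℝ) (m : L2 (Ioo a b) ℂ) :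
    ofComplex a b m =ᵐ[volume.restrict (Ioo a b)] fun t => !₂[(m t).re, (m t).im] := by
  refine (ContinuousLinearMap.coeFn_compLpL (p := 2) (μ := volume.restrict (Ioo a b)) _ m).trans
    (Eventually.of_forall fun t => ?_)
  ext i
  fin_cases i <;> simp

theorem toComplex_ofComplex (a b : ℝ) (m : L2 (Ioo a b) ℂ) :
    toComplex a b (ofComplex a b m) = m := by
  refine Lp.ext ?_
  filter_upwards [coeFn_toComplex a b (ofComplex a b m), coeFn_ofComplex a b m] with t h1 h2
  rw [h1, h2]
  simp [mul_comm Complex.I]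

theorem ofComplex_toComplex (a b : ℝ) (m : L2 (Ioo a b) (EuclideanSpace ℝ (Fin 2))) :
    ofComplex a b (toComplex a b m) = m := by
  refine Lp.ext ?_
  filter_upwards [coeFn_toComplex a b m, coeFn_ofComplex a b (toComplex a b m)] with t h1 h2
  rw [h2, h1]
  ext i
  fin_cases i <;> simp

theorem indicator_coord (a b : ℝ) (m : L2 (Ioo a b) (EuclideanSpace ℝ (Fin 2))) :
    (Ioo a b).indicator (toComplex a b m) =ᵐ[volume] fun t =>
      (((Ioo a b).indicator (fun t => m t 0) t : ℝ) : ℂ) +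
        Complex.I * (((Ioo a b).indicator (fun t => m t 1) t : ℝ) : ℂ) := by
  refine ((ae_eq_restrict_iff_indicator_ae_eq measurableSet_Ioo).1
    (coeFn_toComplex a b m)).trans (Eventually.of_forall fun t => ?_)
  by_cases ht : t ∈ Ioo a b <;> simp [ht]

theorem memLp_coord_indicator {a b : ℝ} (m : L2 (Ioo a b) (EuclideanSpace ℝ (Fin 2)))
    (i : Fin 2) : MemLp ((Ioo a b).indicator fun t => m t i) 2 volume :=
  (memLp_indicator_iff_restrict measurableSet_Ioo).2
    ((EuclideanSpace.proj (𝕜 := ℝ) i).comp_memLp' (Lp.memLp m))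

theorem integrable_coord_indicator {a b : ℝ} (m : L2 (Ioo a b) (EuclideanSpace ℝ (Fin 2)))
    (i : Fin 2) : Integrable ((Ioo a b).indicator fun t => m t i) := by
  refine (integrable_indicator_iff measurableSet_Ioo).2 (memLp_one_iff_integrable.1
    (MemLp.mono_exponent (q := 2) ?_ (by norm_num)))
  exact (EuclideanSpace.proj (𝕜 := ℝ) i).comp_memLp' (Lp.memLp m)

theorem B₂_toComplex {h : ℝ} (hh : 0 < h) (a b c d : ℝ)
    (m : L2 (Ioo a b) (EuclideanSpace ℝ (Fin 2))) :
    B₂ hh a b c d (toComplex a b m) = b₂ hh a b c d m := by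
  refine Lp.ext ?_
  filter_upwards [coeFn_B₂ hh a b c d (toComplex a b m), coeFn_b₂ hh a b c d m] with x h1 h2
  rw [h1, h2, analyticField, cauchyPow_congr 2 (indicator_coord a b m), ← analyticField,
    analyticField_eq hh (memLp_coord_indicator m 0) (memLp_coord_indicator m 1)]
  simp

theorem integral_mul_conv {k k' : ℝ → ℝ} {C : ℝ} (hk : Measurable k) (hC : ∀ x, |k x| ≤ C)
    (hk' : ∀ x, k' (-x) = k x) {f g : ℝ → ℝ} (hf : Integrable f) (hg : Integrable g) :
    ∫ x, g x * conv k f x = ∫ t, f t * conv k' g t := by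
  have hint : Integrable (fun p : ℝ × ℝ => k (p.1 - p.2) * (g p.1 * f p.2))
      (volume.prod volume) :=
    (hg.mul_prod hf).bdd_mul (hk.comp (measurable_fst.sub measurable_snd)).aestronglyMeasurable
      (Eventually.of_forall fun p => hC _)
  simp only [conv_apply, ← integral_const_mul, smul_eq_mul]
  calc ∫ x, ∫ t, g x * (k (x - t) * f t) = ∫ x, ∫ t, k (x - t) * (g x * f t) := by
        congr 1; funext x; congr 1; funext t; ring
    _ = ∫ t, ∫ x, k (x - t) * (g x * f t) := integral_integral_swap hint
    _ = ∫ t, ∫ x, f t * (k' (t - x) * g x) := by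
        congr 1; funext t; congr 1; funext x
        rw [← hk' (x - t), neg_sub]; ring

/-- Fubini moves each convolution onto `φ`. The kernel `dxP h` is odd and `dyP h` is even, so
transposition changes the sign of the first term only. The result is the pair of real and imaginary
parts of the analytic field of the real source `φ`. -/
theorem inner_b₂ {h : ℝ} (hh : 0 < h) (a b c d : ℝ)
    (m : L2 (Ioo a b) (EuclideanSpace ℝ (Fin 2))) (φ : L2 (Ioo c d) ℝ) :
    inner ℝ (b₂ hh a b c d m) φ = inner ℝ m (ofComplex a b (B₂star hh a b c d φ)) := by
  set f : Fin 2 → ℝ → ℝ := fun i => (Ioo a b).indicator fun t => m t i with hf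
  set g : ℝ → ℝ := (Ioo c d).indicator φ with hg
  have hfi : ∀ i, Integrable (f i) := integrable_coord_indicator m
  have hgi : Integrable g := integrable_indicator_L2 φ
  have hg2 : MemLp g 2 := memLp_indicator φ
  have hf2 : ∀ i, MemLp (f i) 2 := memLp_coord_indicator m
  have hbd : ∀ (k : ℝ → ℝ), (∀ x, |k x| ≤ 1 / 2 * (x ^ 2 + h ^ 2)⁻¹) → ∀ x,
      |k x| ≤ 1 / 2 * (h ^ 2)⁻¹ := fun k hk x => by
    refine (hk x).trans ?_
    gcongr
    nlinarith [sq_nonneg x]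
  have hprod : ∀ {k : ℝ → ℝ}, MemLp k 2 → ∀ {u v : ℝ → ℝ}, MemLp u 2 → Integrable v →
      Measurable k → Integrable fun x => v x * conv k u x := by
    intro k hk u v hu hv hkm
    have h1 : conv k u = conv k (hu.toLp u) := conv_congr k hu.coeFn_toLp.symm
    rw [h1]
    refine hv.mul_bdd (c := (eLpNorm k 2 volume).toReal * ‖hu.toLp u‖) ?_
      (Eventually.of_forall fun x => norm_conv_le hk _ x)
    simpa using aestronglyMeasurable_conv hkm (hu.toLp u) univ
  have e1 := integral_mul_conv (k' := fun x => -dxP h x) (measurable_dxP h)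
    (hbd _ (abs_dxP_le hh)) (fun x => by simp [dxP, neg_div]) (hfi 0) hgi
  have e2 := integral_mul_conv (k' := dyP h) (measurable_dyP h)
    (hbd _ (abs_dyP_le hh)) (fun x => by simp [dyP]) (hfi 1) hgi
  have e3 : ∀ t, conv (fun x => -dxP h x) g t = -conv (dxP h) g t := fun t => by
    simp only [conv_apply, neg_smul, integral_neg]
  simp only [e3, mul_neg, integral_neg] at e1
  have hL : inner ℝ (b₂ hh a b c d m) φ =
      -∫ x, (g x * conv (dxP h) (f 0) x + g x * conv (dyP h) (f 1) x) := by
    rw [L2.inner_def, ← integral_neg]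
    refine Eq.trans (integral_congr_ae ?_) (setIntegral_eq_integral_of_forall_compl_eq_zero
      (s := Ioo c d) fun x hx => by simp [hg, hx])
    filter_upwards [coeFn_b₂ hh a b c d m, ae_restrict_mem measurableSet_Ioo] with x h1 hx
    rw [h1]
    simp only [hg, indicator_of_mem hx, RCLike.inner_apply, conj_trivial]
    ring
  have hR : inner ℝ m (ofComplex a b (B₂star hh a b c d φ)) =
      ∫ t, (f 0 t * conv (dxP h) g t - f 1 t * conv (dyP h) g t) := by
    rw [L2.inner_def]
    refine Eq.trans (integral_congr_ae ?_) (setIntegral_eq_integral_of_forall_compl_eq_zero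
      (s := Ioo a b) fun x hx => by simp [hf, hx])
    filter_upwards [coeFn_ofComplex a b (B₂star hh a b c d φ), coeFn_B₂star hh a b c d φ,
      ae_restrict_mem measurableSet_Ioo] with t h1 h2 ht
    have h3 := analyticField_eq hh hg2 (MemLp.zero (p := 2)) t
    simp only [Pi.zero_apply, Complex.ofReal_zero, mul_zero, add_zero] at h3
    have h4 : ∀ k, conv k (0 : ℝ → ℝ) t = 0 := fun k => by simp [conv_apply]
    rw [h1, h2, ← hg, h3, PiLp.inner_apply, Fin.sum_univ_two]
    simp only [hf, h4, indicator_of_mem ht]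
    simp
    ring
  rw [hL, hR, integral_add (hprod (memLp_dxP hh) (hf2 0) hgi (measurable_dxP h))
    (hprod (memLp_dyP hh) (hf2 1) hgi (measurable_dyP h)),
    integral_sub (hprod (memLp_dxP hh) hg2 (hfi 0) (measurable_dxP h))
    (hprod (memLp_dyP hh) hg2 (hfi 1) (measurable_dyP h)), e1, e2]
  ring

theorem b₂star_apply {h : ℝ} (hh : 0 < h) (a b c d : ℝ) (φ : L2 (Ioo c d) ℝ) :
    b₂star hh a b c d φ = ofComplex a b (B₂star hh a b c d φ) :=
  ext_inner_left ℝ fun m => by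
    rw [b₂star, ContinuousLinearMap.adjoint_inner_right, inner_b₂]

theorem toComplex_b₂star {h : ℝ} (hh : 0 < h) (a b c d : ℝ) (φ : L2 (Ioo c d) ℝ) :
    toComplex a b (b₂star hh a b c d φ) = B₂star hh a b c d φ := by
  rw [b₂star_apply, toComplex_ofComplex]

end Magnet2D

/-! ### Hilbert space arguments: dense ranges and divergence of minimizing sequences. -/

namespace Magnet2D

theorem isGLB_norm_sub_of_denseRange {X F : Type*} [NormedAddCommGroup F]
    {T : X → F} (hd : DenseRange T) (e : F) :
    IsGLB (range fun x => ‖T x - e‖) 0 := by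
  refine ⟨by rintro _ ⟨x, rfl⟩; exact norm_nonneg _, fun r hr => ?_⟩
  refine le_of_forall_pos_le_add fun ε hε => ?_
  obtain ⟨x, hx⟩ := hd.exists_dist_lt e hε
  rw [dist_comm, dist_eq_norm] at hx
  rw [zero_add]
  exact (hr ⟨x, rfl⟩).trans hx.le

theorem not_isClosed_range {X Y : Type*} [TopologicalSpace Y] {T : X → Y} (hd : DenseRange T)
    (hs : ¬ Function.Surjective T) : ¬ IsClosed (range T) := fun hc =>
  hs (range_eq_univ.1 (hc.closure_eq ▸ hd.closure_range))

section Functional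

variable {E F : Type*} [NormedAddCommGroup E] [InnerProductSpace ℝ E] [CompleteSpace E]
  [NormedAddCommGroup F] [InnerProductSpace ℝ F] [CompleteSpace F]

/-- The orthogonal complement of the range is the kernel of the adjoint. -/
theorem denseRange_of_adjoint_injective (T : E →L[ℝ] F)
    (h : ∀ y, ContinuousLinearMap.adjoint T y = 0 → y = 0) : DenseRange T := by
  have h1 : T.rangeᗮ = ⊥ := by
    rw [Submodule.eq_bot_iff]
    intro y hy
    refine h y (ext_inner_left ℝ fun x => ?_)
    rw [ContinuousLinearMap.adjoint_inner_right, inner_zero_right]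
    exact (Submodule.mem_orthogonal _ _).1 hy (T x) (LinearMap.mem_range_self _ x)
  have h2 := Submodule.topologicalClosure_eq_top_iff.2 h1
  have h3 := (Submodule.dense_iff_topologicalClosure_eq_top (s := T.range)).2 h2
  exact h3

/-- Approximate solutions of `T x = e` with bounded norms yield an exact solution. -/
theorem tendsto_norm_atTop_of_notMem_range (T : E →L[ℝ] F) {e : F} (he : e ∉ range T)
    {φ : ℕ → E} (hφ : Tendsto (fun n => ‖T (φ n) - e‖) atTop (𝓝 0)) :
    Tendsto (fun n => ‖φ n‖) atTop atTop := by
  by_contra hcon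
  obtain ⟨M, hM⟩ : ∃ M, ∃ᶠ n in atTop, ‖φ n‖ < M := by
    by_contra! h
    exact hcon (tendsto_atTop.2 h)
  have : (atTop ⊓ 𝓟 {n | ‖φ n‖ < M}).NeBot := frequently_mem_iff_neBot.1 hM
  -- An ultrafilter on the indices with `‖φ n‖ < M`, finer than `atTop`, replaces the extraction of
  -- a weakly convergent subsequence.
  set U := Ultrafilter.of (atTop ⊓ 𝓟 {n | ‖φ n‖ < M})
  have hU : (U : Filter ℕ) ≤ atTop ⊓ 𝓟 {n | ‖φ n‖ < M} := Ultrafilter.of_le _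
  set ψ : ℕ → WeakDual ℝ E := fun n =>
    StrongDual.toWeakDual (InnerProductSpace.toDual ℝ E (φ n)) with hψ
  have hmem : ∀ᶠ n in (U : Filter ℕ),
      ψ n ∈ WeakDual.toStrongDual ⁻¹' Metric.closedBall (0 : StrongDual ℝ E) M := by
    have h1 : ∀ᶠ n in (U : Filter ℕ), ‖φ n‖ < M := hU (mem_inf_of_right (mem_principal_self _))
    filter_upwards [h1] with n hn
    simpa [hψ] using hn.le
  -- Banach–Alaoglu, after the Riesz identification of `E` with its dual.
  obtain ⟨l, -, hl⟩ := (WeakDual.isCompact_closedBall (𝕜 := ℝ) (0 : StrongDual ℝ E)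
    M).ultrafilter_le_nhds (U.map ψ) (le_principal_iff.2 hmem)
  have hl' : Tendsto ψ U (𝓝 l) := hl
  set x := (InnerProductSpace.toDual ℝ E).symm (WeakDual.toStrongDual l) with hx
  refine he ⟨x, ext_inner_right ℝ fun y => ?_⟩
  -- Weak-star convergence is tested on the vector `T* y`, since `⟨T φₙ, y⟩ = ⟨φₙ, T* y⟩`.
  have h1 : Tendsto (fun n => inner ℝ (T (φ n)) y) U (𝓝 (inner ℝ (T x) y)) := by
    have h2 := ((WeakDual.eval_continuous (ContinuousLinearMap.adjoint T y)).tendsto l).comp hl'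
    have h3 : inner ℝ (T x) y = l (ContinuousLinearMap.adjoint T y) := by
      rw [← ContinuousLinearMap.adjoint_inner_right, hx, InnerProductSpace.toDual_symm_apply]
      rfl
    rw [h3]
    refine h2.congr fun n => ?_
    rw [← ContinuousLinearMap.adjoint_inner_right]
    rfl
  have h4 : Tendsto (fun n => inner ℝ (T (φ n)) y) U (𝓝 (inner ℝ e y)) :=
    ((tendsto_iff_norm_sub_tendsto_zero.2 hφ).mono_left (hU.trans inf_le_left)).inner
      tendsto_const_nhds
  exact tendsto_nhds_unique h1 h4

end Functional

/-! ### Rigidity of the analytic field and its consequences for the ranges. -/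

theorem continuous_analyticField {h : ℝ} (hh : 0 < h) {u : ℝ → ℂ} (hu : Integrable u) :
    Continuous (analyticField h u) := by
  refine continuous_const.mul (continuous_iff_continuousAt.2 fun x => ?_)
  have h1 := (hasDerivAt_cauchyPow 2 hu (z := x + h * Complex.I) (by simpa using hh)).continuousAt
  exact ContinuousAt.comp (f := fun x : ℝ => (x : ℂ) + h * Complex.I) h1 (by fun_prop)

/-- If a component of the analytic field is constant on an interval, then it vanishes, and the
source vanishes as well when it has bounded support. -/
theorem analyticField_rigid {h : ℝ} (hh : 0 < h) {u : ℝ → ℂ} (hu : Integrable u) {β : ℂ}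
    (hβ : β ≠ 0) {a b r : ℝ} (hab : a < b)
    (H : (fun x => (β * analyticField h u x).re) =ᵐ[volume.restrict (Ioo a b)] fun _ => r) :
    r = 0 ∧ ∀ c d : ℝ, (∀ t ∉ Ioo c d, u t = 0) → u =ᵐ[volume] 0 := by
  -- Continuity upgrades the almost everywhere equality to every point of the open interval.
  have h1 : EqOn (fun x => (β * analyticField h u x).re) (fun _ => r) (Ioo a b) :=
    Measure.eqOn_open_of_ae_eq H isOpen_Ioo
      (Complex.continuous_re.comp
        (continuous_const.mul (continuous_analyticField hh hu))).continuousOn continuousOn_const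
  have h2 := re_cauchyPow_eq_zero 1 hu hh (β * -(Complex.I / Real.pi)) (r := r) hab fun x hx => by
    rw [mul_assoc]; exact h1 hx
  refine ⟨h2.1, fun c d hs => ?_⟩
  have hα : β * -(Complex.I / Real.pi) ≠ 0 := by
    simp [hβ, Real.pi_ne_zero]
  refine ae_eq_zero_of_cauchyPow_two hu (R := max |c| |d|) (fun t ht => hs t fun hcd => ?_)
    fun z hz => cauchyPow_eq_zero_of_re hu hh hα h2.2 hz
  exact (abs_le_max_abs_abs hcd.1.le hcd.2.le).not_gt ht

theorem Lp_eq_zero_of_indicator {E : Type*} [NormedAddCommGroup E] {a b : ℝ} {u : L2 (Ioo a b) E}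
    (h : (Ioo a b).indicator u =ᵐ[volume] 0) : u = 0 := by
  refine Lp.ext (EventuallyEq.trans ?_ (Lp.coeFn_zero _ _ _).symm)
  refine (ae_eq_restrict_iff_indicator_ae_eq measurableSet_Ioo).2 (h.trans ?_)
  rw [indicator_zero']

variable {h : ℝ} (hh : 0 < h) {a b c d : ℝ}

theorem B₂star_eq_zero (hS : a < b) {φ : L2 (Ioo c d) ℝ} (h0 : B₂star hh a b c d φ = 0) :
    φ = 0 := by
  have h1 := coeFn_B₂star hh a b c d φ
  rw [h0] at h1
  have h2 := (analyticField_rigid hh (integrable_indicator_L2 φ).ofReal one_ne_zero hS (r := 0)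
    (by
      filter_upwards [h1, Lp.coeFn_zero ℂ 2 (volume.restrict (Ioo a b))] with x k1 k2
      rw [one_mul]
      refine (congrArg Complex.re (k1.symm.trans k2)).trans ?_
      simp)).2 c d (fun t ht => by simp [ht])
  refine Lp_eq_zero_of_indicator ?_
  filter_upwards [h2] with t ht
  exact Complex.ofReal_eq_zero.1 ht

/-- Only the real part of the field of `m₁ + i m₂` is observed, yet rigidity recovers both
components from it. -/
theorem b₂_eq_zero (hK : c < d) {m : L2 (Ioo a b) (EuclideanSpace ℝ (Fin 2))}
    (h0 : b₂ hh a b c d m = 0) : m = 0 := by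
  rw [← B₂_toComplex] at h0
  have h1 := coeFn_B₂ hh a b c d (toComplex a b m)
  rw [h0] at h1
  have h2 := (analyticField_rigid hh (integrable_indicator_L2 (toComplex a b m))
    (neg_ne_zero.2 one_ne_zero) hK (r := 0)
    (by
      filter_upwards [h1, Lp.coeFn_zero ℝ 2 (volume.restrict (Ioo c d))] with x k1 k2
      rw [neg_one_mul, Complex.neg_re]
      exact k1.symm.trans k2)).2 a b (fun t ht => by simp [ht])
  rw [← ofComplex_toComplex a b m, Lp_eq_zero_of_indicator h2, map_zero]

theorem denseRange_b₂ (hS : a < b) : DenseRange (b₂ hh a b c d) :=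
  denseRange_of_adjoint_injective _ fun φ hφ => by
    refine B₂star_eq_zero hh hS (a := a) (b := b) ?_
    rw [← toComplex_b₂star, b₂star, hφ, map_zero]

theorem denseRange_b₂star (hK : c < d) : DenseRange (b₂star hh a b c d) :=
  denseRange_of_adjoint_injective _ fun m hm => by
    rw [b₂star, ContinuousLinearMap.adjoint_adjoint] at hm
    exact b₂_eq_zero hh hK hm

theorem denseRange_B₂ (hS : a < b) : DenseRange (B₂ hh a b c d) := by
  refine (denseRange_b₂ hh (a := a) (b := b) (c := c) (d := d) hS).mono ?_
  rintro _ ⟨m, rfl⟩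
  exact ⟨_, B₂_toComplex hh a b c d m⟩

theorem denseRange_B₂star (hK : c < d) : DenseRange (B₂star hh a b c d) := by
  have h1 : Function.Surjective (toComplex a b) := fun m => ⟨_, toComplex_ofComplex a b m⟩
  have h2 := h1.denseRange.comp (denseRange_b₂star hh (a := a) (b := b) hK)
    (toComplex a b).continuous
  refine h2.mono ?_
  rintro _ ⟨φ, rfl⟩
  exact ⟨φ, (toComplex_b₂star hh a b c d φ).symm⟩

/-- A preimage would give a field whose negated real part is the constant `1`, whereas rigidity
allows only the constant `0`. -/
theorem const_notMem_range_B₂ (hK : c < d) :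
    Lp.const 2 (volume.restrict (Ioo c d)) (1 : ℝ) ∉ range (B₂ hh a b c d) := by
  rintro ⟨m, hm⟩
  have h1 := coeFn_B₂ hh a b c d m
  rw [hm] at h1
  refine one_ne_zero (analyticField_rigid hh (integrable_indicator_L2 m)
    (neg_ne_zero.2 one_ne_zero) hK (r := 1) ?_).1
  filter_upwards [h1, Lp.coeFn_const (p := 2) (μ := volume.restrict (Ioo c d)) (1 : ℝ)]
    with x k1 k2
  rw [neg_one_mul, Complex.neg_re]
  exact k1.symm.trans k2

theorem momentVec_notMem_range (hS : a < b) (i : Fin 2) :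
    momentVec a b i ∉ range (b₂star hh a b c d) := by
  rintro ⟨φ, hφ⟩
  have h1 := coeFn_B₂star hh a b c d φ
  rw [← toComplex_b₂star, hφ] at h1
  have h2 : analyticField h (fun t => (((Ioo c d).indicator φ t : ℝ) : ℂ))
      =ᵐ[volume.restrict (Ioo a b)] fun _ => ![1, Complex.I] i := by
    filter_upwards [h1, coeFn_toComplex a b (momentVec a b i), Lp.coeFn_const (p := 2)
      (μ := volume.restrict (Ioo a b)) (EuclideanSpace.single i (1 : ℝ))] with x k1 k2 k3
    have k3' : momentVec a b i x = EuclideanSpace.single i (1 : ℝ) := k3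
    rw [← k1, k2, k3']
    fin_cases i <;> simp
  -- As complex functions `e₁` and `e₂` are the constants `1` and `i`. The factors `1` and `-i`
  -- bring both to the value `1`.
  have hβ : (![1, -Complex.I] i : ℂ) ≠ 0 := by fin_cases i <;> simp
  refine one_ne_zero (analyticField_rigid hh (integrable_indicator_L2 φ).ofReal hβ hS (r := 1)
    ?_).1
  filter_upwards [h2] with x hx
  refine (congrArg (fun z => (![1, -Complex.I] i * z : ℂ).re) hx).trans ?_
  fin_cases i <;> simp

theorem not_surjective_b₂ (hK : c < d) : ¬ Function.Surjective (b₂ hh a b c d) := fun hs => by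
  obtain ⟨m, hm⟩ := hs (Lp.const 2 (volume.restrict (Ioo c d)) (1 : ℝ))
  exact const_notMem_range_B₂ hh hK ⟨_, (B₂_toComplex hh a b c d m).trans hm⟩

theorem not_surjective_B₂ (hK : c < d) : ¬ Function.Surjective (B₂ hh a b c d) := fun hs =>
  const_notMem_range_B₂ hh hK (hs _)

theorem not_surjective_b₂star (hS : a < b) : ¬ Function.Surjective (b₂star hh a b c d) :=
  fun hs => momentVec_notMem_range hh hS 0 (hs _)

theorem not_surjective_B₂star (hS : a < b) : ¬ Function.Surjective (B₂star hh a b c d) :=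
  fun hs => by
    obtain ⟨φ, hφ⟩ := hs (toComplex a b (momentVec a b 0))
    refine momentVec_notMem_range hh hS 0 ⟨φ, ?_⟩
    rw [b₂star_apply, hφ, ofComplex_toComplex]

end Magnet2D

/-- Non-closed ranges, non-surjectivity, and ill-posedness of the unconstrained moment-estimation
problem `min_φ ‖b₂*[φ] - e‖`, in particular for `e = e₁, e₂`: the infimum is `0`, it is not
attained, and every minimizing sequence diverges in norm. Here `S = (a, b)`, `K = (c, d)`. -/
theorem proposition3p6 (h : ℝ) (hh : 0 < h) (a b c d : ℝ) (hS : a < b) (hK : c < d) :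
    (¬ IsClosed (Set.range (Magnet2D.b₂ hh a b c d)) ∧
      ¬ IsClosed (Set.range (Magnet2D.B₂ hh a b c d)) ∧
      ¬ IsClosed (Set.range (Magnet2D.b₂star hh a b c d)) ∧
      ¬ IsClosed (Set.range (Magnet2D.B₂star hh a b c d))) ∧
    (¬ Function.Surjective (Magnet2D.b₂ hh a b c d) ∧
      ¬ Function.Surjective (Magnet2D.B₂ hh a b c d) ∧
      ¬ Function.Surjective (Magnet2D.b₂star hh a b c d) ∧
      ¬ Function.Surjective (Magnet2D.B₂star hh a b c d)) ∧
    (∀ i : Fin 2, Magnet2D.momentVec a b i ∉ Set.range (Magnet2D.b₂star hh a b c d)) ∧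
    (∀ e : Magnet2D.L2 (Set.Ioo a b) (EuclideanSpace ℝ (Fin 2)),
      e ∉ Set.range (Magnet2D.b₂star hh a b c d) →
        IsGLB (Set.range fun φ : Magnet2D.L2 (Set.Ioo c d) ℝ =>
          ‖Magnet2D.b₂star hh a b c d φ - e‖) 0 ∧
        ∀ φ : ℕ → Magnet2D.L2 (Set.Ioo c d) ℝ,
          Tendsto (fun n => ‖Magnet2D.b₂star hh a b c d (φ n) - e‖) atTop (𝓝 0) →
            Tendsto (fun n => ‖φ n‖) atTop atTop) := by
  have s1 := Magnet2D.not_surjective_b₂ hh (a := a) (b := b) hK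
  have s2 := Magnet2D.not_surjective_B₂ hh (a := a) (b := b) hK
  have s3 := Magnet2D.not_surjective_b₂star hh (c := c) (d := d) hS
  have s4 := Magnet2D.not_surjective_B₂star hh (c := c) (d := d) hS
  exact ⟨⟨Magnet2D.not_isClosed_range (Magnet2D.denseRange_b₂ hh hS) s1,
    Magnet2D.not_isClosed_range (Magnet2D.denseRange_B₂ hh hS) s2,
    Magnet2D.not_isClosed_range (Magnet2D.denseRange_b₂star hh hK) s3,
    Magnet2D.not_isClosed_range (Magnet2D.denseRange_B₂star hh hK) s4⟩, ⟨s1, s2, s3, s4⟩,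
    Magnet2D.momentVec_notMem_range hh hS, fun e he =>
      ⟨Magnet2D.isGLB_norm_sub_of_denseRange (Magnet2D.denseRange_b₂star hh hK) e,
        fun _ => Magnet2D.tendsto_norm_atTop_of_notMem_range _ he⟩⟩
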